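/- **Theorem (Equivalence of CJupiter and Jupiter).** Consider a replicated list in a client/server system with $n$ clients $c_1,\dots,c_n$ and a server $s$ that generates no operations; clients and server communicate through reliable FIFO channels. Let $OT$ be any transformation function on list operations ($\textsc{Ins}$, $\textsc{Del}$, $\textsc{Read}$, $\textsc{Nop}$), for instance the usual one, and let any initial list be given. Every operation generated by a client carries a unique identifier (client, sequence number) and, as its context, the set of identifiers of the operations that the client has executed before it. A set of identifiers is used to name a vertex of a state space; an edge from $u$ labeled with an operation with identifier $x$ leads to $u\cup\{x\}$. *CJupiter.* Every replica keeps one ordered state space (each vertex has a sorted list of outgoing edges) with a current vertex. A client executes its own operations at once, appends them at the current vertex and sends them to the server. The server attaches to a received operation the set of operations it has executed so far (this set determines the order of edges), and sends this original operation to all other clients. The server, and a client that receives an operation from it, transform the operation successively, from the vertex that equals its context, with the operations along the *first* edges up to the current vertex (adding the resulting vertices and edges), and execute the result. *Jupiter.* Every client keeps one 2D state space (each vertex has at most one local and one global edge), and the server keeps one for each client. A client executes its own operations at once, appends them along the local dimension and sends them to the server. The server transforms an operation received from $c_i$ along the global dimension of its space for $c_i$, executes the result, appends it along the global dimension to its spaces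 for all other clients, and sends this *transformed* operation to them. A client transforms an operation received from the server along the local dimension of its space and executes the result. The *schedule* of an execution consists of the operations generated by each client, the causally-before relation $\to$ on these operations (generated by the order of events at each replica and by message delivery), and the total order $\prec_s$ in which the server receives operations. The *behavior* of a replica in an execution is the sequence of its state transitions $\sigma_0,e_1,\sigma_1,e_2,\sigma_2,\dots$, where each $e_k$ is either the invocation of an operation together with its response (the new list) or the receipt of the operation with a given identifier, and $\sigma_k$ is the sequence of (transformed) list operations that the replica has executed after $e_k$, which determines its list content. Let $\alpha$ be a well-formed finite execution of CJupiter and $\beta$ a well-formed finite execution of Jupiter (every receive event is preceded by the corresponding send event) with the same schedule. Then no step of either protocol gets stuck, and corresponding replicas have the same behavior: for every replica $R$ the $k$-th state transitions of $R$ in $\alpha$ and in $\beta$ are equal for every $k$ for which both exist. Consequently the behaviors of the two servers are equal, and so are those of the two copies of each client that has taken the same number of steps in $\alpha$ and $\beta$ (in particular of all clients, if all messages have been delivered in both executions). -/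

import Mathlib

universe u

namespace JupiterOT

/-! ## The replicated list -/

/-- User operations on the replicated list.  `pos` is a zero-based position, `pr` the priority used
to break ties between concurrent insertions; a deletion records the deleted element. -/
inductive ListOp (U : Type u) : Type u
  | ins (a : U) (pos : ℕ) (pr : ℕ)
  | del (a : U) (pos : ℕ) (pr : ℕ)
  | read
  | nop

/-- The effect of an operation on a list.  Positions beyond the end mean the end of the list. -/
def ListOp.perform {U : Type u} (l : List U) : ListOp U → List U
  | .ins a p _ => l.insertIdx (min p l.length) a
  | .del _ p _ => l.eraseIdx (min p (l.length - 1))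
  | .read => l
  | .nop => l

/-- A replica state is the sequence of the operations executed so far; its list content is the
result of performing them on the initial list `l₀`. -/
def content {U : Type u} (l₀ : List U) (σ : List (ListOp U)) : List U :=
  σ.foldl ListOp.perform l₀

/-- The usual transformation function for lists: `listOT o₁ o₂` is `o₁` transformed with `o₂`.  The
protocols below are defined for every transformation function, of which this is an example. -/
def listOT {U : Type u} : ListOp U → ListOp U → ListOp U
  | .ins a₁ p₁ r₁, .ins _ p₂ r₂ =>
      if p₁ < p₂ then .ins a₁ p₁ r₁
      else if p₂ < p₁ then .ins a₁ (p₁ + 1) r₁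
      else if r₂ < r₁ then .ins a₁ (p₁ + 1) r₁
      else .ins a₁ p₁ r₁
  | .ins a₁ p₁ r₁, .del _ p₂ _ =>
      if p₁ ≤ p₂ then .ins a₁ p₁ r₁ else .ins a₁ (p₁ - 1) r₁
  | .del a₁ p₁ r₁, .ins _ p₂ _ =>
      if p₁ < p₂ then .del a₁ p₁ r₁ else .del a₁ (p₁ + 1) r₁
  | .del a₁ p₁ r₁, .del _ p₂ _ =>
      if p₁ < p₂ then .del a₁ p₁ r₁
      else if p₂ < p₁ then .del a₁ (p₁ - 1) r₁
      else .nop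
  | o, _ => o

/-! ## Replicas, events and executions -/

/-- The replicas: one server and `n` clients. -/
inductive Replica (n : ℕ)
  | server
  | client (i : Fin n)
  deriving DecidableEq

/-- Operation identifiers: the generating client and a sequence number (starting with `1`). -/
abbrev Oid (n : ℕ) : Type := Fin n × ℕ

/-- The events of an execution of a client/server system with FIFO channels.  Messages are sent as
part of `gen` (to the server) and of `serverRecv` (from the server to the other clients). -/
inductive Event (n : ℕ) (U : Type u) : Type u
  /-- a user invokes `o` at client `i` -/
  | gen (i : Fin n) (o : ListOp U)
  /-- the server receives the next message from client `i` -/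
  | serverRecv (i : Fin n)
  /-- client `i` receives the next message from the server -/
  | clientRecv (i : Fin n)

variable {n : ℕ} {U : Type u}

/-- The replica at which an event occurs. -/
def Event.replica : Event n U → Replica n
  | .gen i _ => .client i
  | .serverRecv _ => .server
  | .clientRecv i => .client i

/-- The events of `α` at replica `R`. -/
def eventsAt (α : List (Event n U)) (R : Replica n) : List (Event n U) :=
  α.filter fun e => e.replica = R

/-- The operations generated by client `i`, in order. -/
def generated (i : Fin n) (α : List (Event n U)) : List (ListOp U) :=
  α.filterMap fun e => match e with
    | .gen j o => if j = i then some o else none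
    | _ => none

/-- The number of messages that client `i` has sent to the server. -/
def sentToServer (i : Fin n) (α : List (Event n U)) : ℕ :=
  (generated i α).length

/-- The number of messages that the server has received from client `i`. -/
def receivedFrom (i : Fin n) (α : List (Event n U)) : ℕ :=
  α.countP fun e => match e with
    | .serverRecv j => j = i
    | _ => false

/-- The number of messages that the server has sent to client `i`: one for every operation received
from another client. -/
def sentToClient (i : Fin n) (α : List (Event n U)) : ℕ :=
  α.countP fun e => match e with
    | .serverRecv j => j ≠ i
    | _ => false

/-- The number of messages that client `i` has received from the server. -/
def receivedBy (i : Fin n) (α : List (Event n U)) : ℕ :=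
  α.countP fun e => match e with
    | .clientRecv j => j = i
    | _ => false

/-- An execution is well-formed if every receive event is preceded by the corresponding send. -/
def WellFormed (α : List (Event n U)) : Prop :=
  ∀ k : ℕ, ∀ i : Fin n,
    receivedFrom i (α.take k) ≤ sentToServer i (α.take k) ∧
    receivedBy i (α.take k) ≤ sentToClient i (α.take k)

/-! ## Schedules -/

/-- The generating steps of the causally-before relation on the events of `α` (given by their
positions): thread of execution, and delivery of a message.  Channels are FIFO, so the message
received is identified by the number of messages that precede it on its channel. -/
inductive CausalStep (α : List (Event n U)) : ℕ → ℕ → Prop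
  | thread {p q : ℕ} {e e' : Event n U} (hp : α[p]? = some e) (hq : α[q]? = some e')
      (hR : e.replica = e'.replica) (hpq : p < q) : CausalStep α p q
  | toServer {p q : ℕ} {i : Fin n} {o : ListOp U} (hp : α[p]? = some (.gen i o))
      (hq : α[q]? = some (.serverRecv i))
      (hm : sentToServer i (α.take p) = receivedFrom i (α.take q)) : CausalStep α p q
  | toClient {p q : ℕ} {i j : Fin n} (hp : α[p]? = some (.serverRecv j))
      (hq : α[q]? = some (.clientRecv i)) (hij : j ≠ i)
      (hm : sentToClient i (α.take p) = receivedBy i (α.take q)) : CausalStep α p q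

/-- The causally-before relation on the events of `α`. -/
def CausallyBefore (α : List (Event n U)) : ℕ → ℕ → Prop :=
  Relation.TransGen (CausalStep α)

/-- The event of `α` at position `p` is the generation of the operation with identifier `x`. -/
def IsGeneration (α : List (Event n U)) (p : ℕ) (x : Oid n) : Prop :=
  ∃ o, α[p]? = some (.gen x.1 o) ∧ x.2 = sentToServer x.1 (α.take p) + 1

/-- The causally-before relation on user operations. -/
def OpCausallyBefore (α : List (Event n U)) (x y : Oid n) : Prop :=
  ∃ p q, IsGeneration α p x ∧ IsGeneration α q y ∧ CausallyBefore α p q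

/-- The operations that the server has received, in the total order of their receipt. -/
def serverOrder (α : List (Event n U)) : List (Oid n) :=
  (List.range α.length).filterMap fun q => match (α[q]? : Option (Event n U)) with
    | some (.serverRecv i) => some (i, receivedFrom i (α.take q) + 1)
    | _ => none

/-- Two executions have the same schedule: the same user operations, the same causally-before
relation on them, and the same total order established by the server. -/
structure SameSchedule (α β : List (Event n U)) : Prop where
  operations : ∀ i, generated i α = generated i β
  causal : ∀ x y, OpCausallyBefore α x y ↔ OpCausallyBefore β x y
  server : serverOrder α = serverOrder β

/-! ## Protocols and their behaviors -/

/-- A client/server protocol.  A transition that cannot be carried out yields `none`. -/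
structure Protocol (n : ℕ) (U : Type u) where
  Client : Type u
  Server : Type u
  Msg : Type u
  client₀ : Fin n → Client
  server₀ : Server
  /-- local processing: the new client and the message for the server -/
  clientDo : Client → ListOp U → Client × Msg
  /-- remote processing -/
  clientReceive : Client → Msg → Option Client
  /-- server processing: the new server and the messages for the clients -/
  serverReceive : Server → Msg → Option (Server × (Fin n → Option Msg))
  /-- the sequence of operations executed by a client -/
  clientState : Client → List (ListOp U)
  /-- the sequence of operations executed by the server -/
  serverState : Server → List (ListOp U)
  /-- the identifier of the operation carried by a message -/
  msgOid : Msg → Oid n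

/-- The event of a state transition of a replica: the invocation of `o` with the response `v`, or
the receipt of (a message carrying) the operation `x`. -/
inductive LocalEvent (n : ℕ) (U : Type u) : Type u
  | doOp (o : ListOp U) (v : List U)
  | receive (x : Oid n)

/-- A state transition of a replica. -/
structure Transition (n : ℕ) (U : Type u) : Type u where
  source : List (ListOp U)
  event : LocalEvent n U
  target : List (ListOp U)
  /-- the list content of the target state -/
  val : List U

namespace Protocol

/-- The global state of a system running the protocol `P`: replicas and FIFO channels. -/
structure Config (P : Protocol n U) : Type u where
  clients : Fin n → P.Client
  server : P.Server
  toServer : Fin n → List P.Msg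
  toClient : Fin n → List P.Msg

/-- The initial global state. -/
def config₀ (P : Protocol n U) : P.Config where
  clients := P.client₀
  server := P.server₀
  toServer := fun _ => []
  toClient := fun _ => []

/-- One event of an execution, with the state transition it causes at its replica. -/
def step (P : Protocol n U) (l₀ : List U) (c : P.Config) :
    Event n U → Option (P.Config × Transition n U)
  | .gen i o =>
      let r := P.clientDo (c.clients i) o
      let σ := P.clientState (c.clients i)
      let σ' := P.clientState r.1
      some ({ c with
              clients := Function.update c.clients i r.1
              toServer := Function.update c.toServer i (c.toServer i ++ [r.2]) },
            ⟨σ, .doOp o (content l₀ σ'), σ', content l₀ σ'⟩)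
  | .serverRecv i =>
      match c.toServer i with
      | [] => none
      | m :: ms =>
          (P.serverReceive c.server m).map fun r =>
            let σ' := P.serverState r.1
            ({ c with
               server := r.1
               toServer := Function.update c.toServer i ms
               toClient := fun j => c.toClient j ++ (r.2 j).toList },
             ⟨P.serverState c.server, .receive (P.msgOid m), σ', content l₀ σ'⟩)
  | .clientRecv i =>
      match c.toClient i with
      | [] => none
      | m :: ms =>
          (P.clientReceive (c.clients i) m).map fun s =>
            let σ' := P.clientState s
            ({ c with
               clients := Function.update c.clients i s
               toClient := Function.update c.toClient i ms },
             ⟨P.clientState (c.clients i), .receive (P.msgOid m), σ', content l₀ σ'⟩)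

/-- The state transitions caused by a sequence of events, with their replicas. -/
def transitions (P : Protocol n U) (l₀ : List U) :
    P.Config → List (Event n U) → Option (List (Replica n × Transition n U))
  | _, [] => some []
  | c, e :: es =>
      (P.step l₀ c e).bind fun r =>
        (P.transitions l₀ r.1 es).map fun ts => (e.replica, r.2) :: ts

/-- The behavior of replica `R` in the execution `α`: the sequence of its state transitions
(`none` if some event of `α` cannot be carried out). -/
def behavior (P : Protocol n U) (l₀ : List U) (α : List (Event n U)) (R : Replica n) :
    Option (List (Transition n U)) :=
  (P.transitions l₀ P.config₀ α).map fun ts =>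
    (ts.filter fun t => t.1 = R).map Prod.snd

end Protocol

/-! ## CJupiter -/

namespace CJupiter

/-- Operations of CJupiter. -/
structure Op (n : ℕ) (U : Type u) : Type u where
  o : ListOp U
  oid : Oid n
  ctx : Finset (Oid n)
  sctx : Finset (Oid n)

/-- `op` transformed with `op'`. -/
def Op.transform (ot : ListOp U → ListOp U → ListOp U) (op op' : Op n U) : Op n U :=
  ⟨ot op.o op'.o, op.oid, insert op'.oid op.ctx, op.sctx⟩

/-- At replica `r`, the operation `op` is ordered before `op'`. -/
def Op.before (r : Replica n) (op op' : Op n U) : Bool :=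
  if op.oid ∈ op'.sctx then true
  else if op'.oid ∈ op.sctx then false
  else if Replica.client op.oid.1 ≠ r then true
  else false

/-- An edge to the vertex `tgt`.  Vertices are identified with their sets of identifiers. -/
structure Edge (n : ℕ) (U : Type u) : Type u where
  op : Op n U
  tgt : Finset (Oid n)

/-- `n`-ary ordered state spaces, with the sorted list of edges from each vertex. -/
structure Space (n : ℕ) (U : Type u) : Type u where
  cur : Finset (Oid n)
  vertices : Finset (Finset (Oid n))
  edges : Finset (Oid n) → List (Edge n U)

/-- The initial state space, with the single vertex `∅`. -/
def Space.empty : Space n U := ⟨∅, {∅}, fun _ => []⟩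

/-- Insertion of an edge into a sorted list of edges. -/
def insertEdge (r : Replica n) (e : Edge n U) : List (Edge n U) → List (Edge n U)
  | [] => [e]
  | e' :: es => if e.op.before r e'.op then e :: e' :: es else e' :: insertEdge r e es

/-- Create the vertex `v`. -/
def Space.addVertex (S : Space n U) (v : Finset (Oid n)) : Space n U :=
  { S with vertices := insert v S.vertices }

/-- Add an edge from `w` to `v` labeled with `op`. -/
def Space.link (r : Replica n) (S : Space n U) (w v : Finset (Oid n)) (op : Op n U) : Space n U :=
  { S with edges := Function.update S.edges w (insertEdge r ⟨op, v⟩ (S.edges w)) }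

/-- The loop of `xForm`, with a bound on the number of iterations. -/
def Space.xFormLoop (ot : ListOp U → ListOp U → ListOp U) (r : Replica n) :
    ℕ → Space n U → Finset (Oid n) → Finset (Oid n) → Op n U → Option (Space n U × Op n U)
  | fuel, S, w, v, op =>
      if w = S.cur then
        some ({ S.link r w v op with cur := v }, op)
      else
        match fuel, (S.edges w).head? with
        | fuel + 1, some e' =>
            let v' := insert e'.op.oid v
            let S₁ := S.addVertex v'
            let S₂ := S₁.link r v v' (e'.op.transform ot op)
            let S₃ := S₂.link r w v op
            Space.xFormLoop ot r fuel S₃ e'.tgt v' (op.transform ot e'.op)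
        | _, _ => none

/-- Transform `op` along the first edges from the vertex matching its context to the final vertex.
Every iteration adds an identifier to the current vertex, so `cur.card` iterations suffice. -/
def Space.xForm (ot : ListOp U → ListOp U → ListOp U) (r : Replica n) (S : Space n U)
    (op : Op n U) : Option (Space n U × Op n U) :=
  if op.ctx ∈ S.vertices then
    let v := insert op.oid op.ctx
    Space.xFormLoop ot r S.cur.card (S.addVertex v) op.ctx v op
  else none

structure Client (n : ℕ) (U : Type u) : Type u where
  cid : Fin n
  seq : ℕ
  state : List (ListOp U)
  S : Space n U

structure Server (n : ℕ) (U : Type u) : Type u where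
  state : List (ListOp U)
  soids : Finset (Oid n)
  S : Space n U

/-- Local processing. -/
def Client.doOp (s : Client n U) (o : ListOp U) : Client n U × Op n U :=
  let op : Op n U := ⟨o, (s.cid, s.seq + 1), s.S.cur, ∅⟩
  let v := insert op.oid s.S.cur
  let S' := (s.S.addVertex v).link (.client s.cid) s.S.cur v op
  (⟨s.cid, s.seq + 1, s.state ++ [o], { S' with cur := v }⟩, op)

/-- Remote processing. -/
def Client.receive (ot : ListOp U → ListOp U → ListOp U) (s : Client n U) (op : Op n U) :
    Option (Client n U) :=
  (s.S.xForm ot (.client s.cid) op).map fun r =>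
    { s with state := s.state ++ [r.2.o], S := r.1 }

/-- Server processing: the operation itself, not the transformed one, is sent to the other
clients. -/
def Server.receive (ot : ListOp U → ListOp U → ListOp U) (s : Server n U) (m : Op n U) :
    Option (Server n U × (Fin n → Option (Op n U))) :=
  let op : Op n U := { m with sctx := s.soids }
  (s.S.xForm ot .server op).map fun r =>
    (⟨s.state ++ [r.2.o], insert op.oid s.soids, r.1⟩,
     fun c => if c = op.oid.1 then none else some op)

/-- The CJupiter protocol with `n` clients and the transformation function `ot`. -/
def protocol (n : ℕ) (ot : ListOp U → ListOp U → ListOp U) : Protocol n U where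
  Client := Client n U
  Server := Server n U
  Msg := Op n U
  client₀ := fun i => ⟨i, 0, [], Space.empty⟩
  server₀ := ⟨[], ∅, Space.empty⟩
  clientDo := Client.doOp
  clientReceive := Client.receive ot
  serverReceive := Server.receive ot
  clientState := Client.state
  serverState := Server.state
  msgOid := Op.oid

end CJupiter

/-! ## Jupiter -/

namespace Jupiter

/-- Operations of Jupiter. -/
structure Op (n : ℕ) (U : Type u) : Type u where
  o : ListOp U
  oid : Oid n
  ctx : Finset (Oid n)

/-- `op` transformed with `op'`. -/
def Op.transform (ot : ListOp U → ListOp U → ListOp U) (op op' : Op n U) : Op n U :=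
  ⟨ot op.o op'.o, op.oid, insert op'.oid op.ctx⟩

/-- The local and the global dimension. -/
inductive Dim
  | loc
  | glob
  deriving DecidableEq

/-- The other dimension. -/
def Dim.other : Dim → Dim
  | loc => glob
  | glob => loc

/-- An edge to the vertex `tgt`.  Vertices are identified with their sets of identifiers. -/
structure Edge (n : ℕ) (U : Type u) : Type u where
  op : Op n U
  tgt : Finset (Oid n)

/-- 2D state spaces: every vertex has at most one edge along each dimension. -/
structure Space (n : ℕ) (U : Type u) : Type u where
  cur : Finset (Oid n)
  vertices : Finset (Finset (Oid n))
  edge : Dim → Finset (Oid n) → Option (Edge n U)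

/-- The initial state space, with the single vertex `∅`. -/
def Space.empty : Space n U := ⟨∅, {∅}, fun _ _ => none⟩

/-- Set the edge from `w` along the dimension `d`, creating its target `v`. -/
def Space.setEdge (S : Space n U) (d : Dim) (w v : Finset (Oid n)) (op : Op n U) : Space n U :=
  { S with
    vertices := insert v S.vertices
    edge := Function.update S.edge d (Function.update (S.edge d) w (some ⟨op, v⟩)) }

/-- The loop of `xForm`, with a bound on the number of iterations. -/
def Space.xFormLoop (ot : ListOp U → ListOp U → ListOp U) (d : Dim) :
    ℕ → Space n U → Finset (Oid n) → Finset (Oid n) → Op n U → Option (Space n U × Op n U)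
  | fuel, S, w, v, op =>
      if w = S.cur then
        some ({ S with cur := v }, op)
      else
        match fuel, S.edge d w with
        | fuel + 1, some e' =>
            let v' := insert e'.op.oid v
            let S₁ := S.setEdge d v v' (e'.op.transform ot op)
            let S₂ := S₁.setEdge d.other e'.tgt v' (op.transform ot e'.op)
            Space.xFormLoop ot d fuel S₂ e'.tgt v' (op.transform ot e'.op)
        | _, _ => none

/-- Transform `op` along the dimension `d` from the vertex matching its context to the final vertex.
Every iteration adds an identifier to the current vertex, so `cur.card` iterations suffice. -/
def Space.xForm (ot : ListOp U → ListOp U → ListOp U) (d : Dim) (S : Space n U) (op : Op n U) :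
    Option (Space n U × Op n U) :=
  if op.ctx ∈ S.vertices then
    let v := insert op.oid op.ctx
    Space.xFormLoop ot d S.cur.card (S.setEdge d.other op.ctx v op) op.ctx v op
  else none

/-- Save `op` at the end of the state space along the dimension `d`. -/
def Space.append (S : Space n U) (d : Dim) (op : Op n U) : Space n U :=
  let v := insert op.oid S.cur
  { S.setEdge d S.cur v op with cur := v }

structure Client (n : ℕ) (U : Type u) : Type u where
  cid : Fin n
  seq : ℕ
  state : List (ListOp U)
  S : Space n U

/-- The server maintains one 2D state space per client. -/
structure Server (n : ℕ) (U : Type u) : Type u where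
  state : List (ListOp U)
  SS : Fin n → Space n U

/-- Local processing. -/
def Client.doOp (s : Client n U) (o : ListOp U) : Client n U × Op n U :=
  let op : Op n U := ⟨o, (s.cid, s.seq + 1), s.S.cur⟩
  (⟨s.cid, s.seq + 1, s.state ++ [o], s.S.append .loc op⟩, op)

/-- Remote processing. -/
def Client.receive (ot : ListOp U → ListOp U → ListOp U) (s : Client n U) (op : Op n U) :
    Option (Client n U) :=
  (s.S.xForm ot .loc op).map fun r =>
    { s with state := s.state ++ [r.2.o], S := r.1 }

/-- Server processing: the transformed operation is saved in the state spaces for the other clients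
and sent to them. -/
def Server.receive (ot : ListOp U → ListOp U → ListOp U) (s : Server n U) (op : Op n U) :
    Option (Server n U × (Fin n → Option (Op n U))) :=
  ((s.SS op.oid.1).xForm ot .glob op).map fun r =>
    (⟨s.state ++ [r.2.o],
      fun c => if c = op.oid.1 then r.1 else (s.SS c).append .glob r.2⟩,
     fun c => if c = op.oid.1 then none else some r.2)

/-- The Jupiter protocol with `n` clients and the transformation function `ot`. -/
def protocol (n : ℕ) (ot : ListOp U → ListOp U → ListOp U) : Protocol n U where
  Client := Client n U
  Server := Server n U
  Msg := Op n U
  client₀ := fun i => ⟨i, 0, [], Space.empty⟩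
  server₀ := ⟨[], fun _ => Space.empty⟩
  clientDo := Client.doOp
  clientReceive := Client.receive ot
  serverReceive := Server.receive ot
  clientState := Client.state
  serverState := Server.state
  msgOid := Op.oid

end Jupiter

end JupiterOT

open JupiterOT

/-!
The two protocols are compared through the schedule.  It determines which operation the server
receives as number `a`, and in which context every operation is generated; both are collected in
`Sched`, and executions with the same schedule yield the same `Sched` (`SameSchedule.schedOf_eq`).

All vertices that matter have the form `vtx i a b`: the first `a` operations of the server together
with the first `b` operations of client `i`.  For fixed `i` they form a grid.  The operation number
`b` of client `i` and the operation number `a` of the server leave `vtx i a b` in the forms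
`locForm` and `globForm`, which are transformed with one another in each cell of the grid, from the
original operation in its context and, on the main axis `b = clock a i`, from the form in which the
server executes its operation number `a`.  This form is in turn the `locForm` of its author at the
main axis, so that everything is defined by recursion on `a`.  No property of the transformation
function is needed, since both protocols compute exactly these forms:

* In Jupiter, the 2D state spaces are pieces of the grids: a client needs the local edges from the
  current main axis vertex, and the server needs, for each client, the global edges at the vertices
  that contain all its received operations (`Jupiter.ClientSpace`, `Jupiter.ServerSpace`).
* In CJupiter, a state space contains pieces of the grids of all clients, and its first edges are
  those of the order "operations of the server first, then the pending ones"
  (`CJupiter.StateSpace`).  The path of first edges from the context of an operation of client `j`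
  runs along the grid of `j` up to the main axis, where the operation has the form that Jupiter's
  server sends, and then, at client `i`, along the grid of `i` (`CJupiter.StateSpace.receive`).  Of
  the sorted lists of edges only the first elements are used.

Both protocols are instances of `Sched.Realization`, whose behavior at a replica depends only on
`Sched` and on the events at the replica (`Sched.Realization.behavior_eq`).  The causally-before
relation fixes how many operations a client has received before each of its invocations
(`opCausallyBefore_iff`), so that the events at a replica in the two executions agree up to messages
received at the end (`Sched.LocallyFollows.comparable`).
-/

namespace JupiterOT

variable {n : ℕ} {U : Type u}

/-! ### Vector clocks -/

/-- The set of identifiers described by a vector clock: the first `q i` operations of each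
client `i`. -/
def clockSet (q : Fin n → ℕ) : Finset (Oid n) :=
  Finset.univ.biUnion fun i => (Finset.range (q i)).image fun b => (i, b + 1)

theorem mem_clockSet {q : Fin n → ℕ} {x : Oid n} : x ∈ clockSet q ↔ 0 < x.2 ∧ x.2 ≤ q x.1 := by
  obtain ⟨i, k⟩ := x
  simp only [clockSet, Finset.mem_biUnion, Finset.mem_univ, true_and, Finset.mem_image,
    Finset.mem_range, Prod.mk.injEq]
  constructor
  · rintro ⟨j, b, hb, rfl, rfl⟩
    omega
  · rintro ⟨h1, h2⟩
    exact ⟨i, k - 1, by omega, rfl, by omega⟩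

theorem clockSet_subset {q q' : Fin n → ℕ} : clockSet q ⊆ clockSet q' ↔ q ≤ q' := by
  constructor
  · intro h i
    by_contra hlt
    rw [not_le] at hlt
    have hi : (i, q i) ∈ clockSet q := mem_clockSet.2 ⟨Nat.zero_lt_of_lt hlt, le_rfl⟩
    exact hlt.not_ge (mem_clockSet.1 (h hi)).2
  · intro h x hx
    rw [mem_clockSet] at hx ⊢
    exact ⟨hx.1, hx.2.trans (h _)⟩

theorem clockSet_injective : Function.Injective (clockSet (n := n)) := by
  intro q q' h
  exact le_antisymm (clockSet_subset.1 h.subset) (clockSet_subset.1 h.superset)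

theorem insert_clockSet (q : Fin n → ℕ) (i : Fin n) :
    insert (i, q i + 1) (clockSet q) = clockSet (Function.update q i (q i + 1)) := by
  ext ⟨j, k⟩
  simp only [Finset.mem_insert, mem_clockSet, Prod.mk.injEq, Function.update_apply]
  by_cases h : j = i
  · subst h
    simp only [true_and, if_true]
    omega
  · simp [h]

theorem notMem_clockSet (q : Fin n → ℕ) (i : Fin n) : (i, q i + 1) ∉ clockSet q := by
  simp [mem_clockSet]

theorem clockSet_zero : clockSet (fun _ : Fin n => 0) = ∅ := by
  ext x
  simp only [mem_clockSet, Finset.notMem_empty, iff_false]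
  omega

/-! ### Schedules and the forms of operations -/

/-- The part of a schedule on which the protocols depend.  The operations are numbered from `0`,
both in the order of their receipt by the server and at the client that generates them: `author a`
is the client that generated the operation number `a` of the server, `orig i b` is the operation
number `b` of client `i`, and `known i b` is the number of operations of other clients that `i` has
received before generating it. -/
@[ext]
structure Sched (n : ℕ) (U : Type u) : Type u where
  author : ℕ → Fin n
  orig : Fin n → ℕ → ListOp U
  known : Fin n → ℕ → ℕ

namespace Sched

variable (s : Sched n U)

/-- The vector clock of the first `a` operations of the server. -/
def clock (a : ℕ) (i : Fin n) : ℕ := Nat.count (fun t => s.author t = i) a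

/-- The number of operations of clients other than `i` among the first `a` of the server. -/
def remote (i : Fin n) (a : ℕ) : ℕ := Nat.count (fun t => s.author t ≠ i) a

/-- The least number of operations of the server that contains `r` operations of clients other
than `i`. -/
noncomputable def pos (i : Fin n) (r : ℕ) : ℕ := sInf {a | r ≤ s.remote i a}

/-- The context of the operation number `b` of client `i` consists of the first `ctxIdx i b`
operations of the server and of the earlier operations of `i`. -/
noncomputable def ctxIdx (i : Fin n) (b : ℕ) : ℕ := s.pos i (s.known i b)

/-- The identifier of the operation number `a` of the server.  Its sequence number is determined
because the channels are FIFO. -/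
def oid (a : ℕ) : Oid n := (s.author a, s.clock a (s.author a) + 1)

/-- The vertex that consists of the first `a` operations of the server and the first `b` operations
of client `i`, where `b` is at least the number of operations of `i` among the former. -/
def vtx (i : Fin n) (a b : ℕ) : Finset (Oid n) := clockSet (Function.update (s.clock a) i b)

variable {s}

theorem clock_zero : s.clock 0 = fun _ => 0 := by
  funext i; simp [clock]

theorem clock_succ (a : ℕ) : s.clock (a + 1) =
    Function.update (s.clock a) (s.author a) (s.clock a (s.author a) + 1) := by
  funext i
  by_cases h : i = s.author a
  · subst h; simp [clock, Nat.count_succ]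
  · simp [clock, Nat.count_succ, h, Ne.symm h]

theorem clock_succ_self {a : ℕ} {i : Fin n} (h : s.author a = i) :
    s.clock (a + 1) i = s.clock a i + 1 := by
  simp [clock, Nat.count_succ, h]

theorem clock_succ_of_ne {a : ℕ} {i : Fin n} (h : s.author a ≠ i) :
    s.clock (a + 1) i = s.clock a i := by
  simp [clock, Nat.count_succ, h]

theorem clock_mono : Monotone s.clock := fun _ _ h _ => Nat.count_monotone _ h

theorem remote_succ_self {a : ℕ} {i : Fin n} (h : s.author a = i) :
    s.remote i (a + 1) = s.remote i a := by
  simp [remote, Nat.count_succ, h]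

theorem remote_succ_of_ne {a : ℕ} {i : Fin n} (h : s.author a ≠ i) :
    s.remote i (a + 1) = s.remote i a + 1 := by
  simp [remote, Nat.count_succ, h]

theorem remote_mono (i : Fin n) : Monotone (s.remote i) := Nat.count_monotone _

theorem pos_le {i : Fin n} {r a : ℕ} (h : r ≤ s.remote i a) : s.pos i r ≤ a := Nat.sInf_le h

@[simp] theorem pos_zero (i : Fin n) : s.pos i 0 = 0 := Nat.le_zero.1 (pos_le (Nat.zero_le _))

theorem le_remote_pos {i : Fin n} {r a : ℕ} (h : r ≤ s.remote i a) :
    r ≤ s.remote i (s.pos i r) :=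
  Nat.sInf_mem (s := {a | r ≤ s.remote i a}) ⟨a, h⟩

theorem remote_pos {i : Fin n} {r a : ℕ} (h : r ≤ s.remote i a) :
    s.remote i (s.pos i r) = r := by
  refine le_antisymm ?_ (le_remote_pos h)
  by_contra! hlt
  obtain hp | ⟨k, hk⟩ : s.pos i r = 0 ∨ ∃ k, s.pos i r = k + 1 := by
    cases s.pos i r <;> simp
  · rw [hp] at hlt; simp [remote] at hlt
  · have : s.remote i (k + 1) ≤ s.remote i k + 1 := by
      by_cases h' : s.author k = i
      · rw [remote_succ_self h']; omega
      · rw [remote_succ_of_ne h']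
    rw [hk] at hlt
    have := pos_le (s := s) (i := i) (r := r) (a := k) (by omega)
    omega

theorem pos_mono {i : Fin n} {r r' a : ℕ} (hr : r ≤ r') (h : r' ≤ s.remote i a) :
    s.pos i r ≤ s.pos i r' :=
  pos_le (hr.trans (le_remote_pos h))

theorem lt_pos_iff {i : Fin n} {r a b : ℕ} (h : r ≤ s.remote i b) :
    a < s.pos i r ↔ s.remote i a < r := by
  constructor
  · intro hlt
    by_contra! hge
    exact absurd (pos_le hge) (by omega)
  · intro hlt
    by_contra! hge
    have := remote_mono (s := s) i hge
    rw [remote_pos h] at this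
    omega

theorem pos_remote_succ {i : Fin n} {a : ℕ} (h : s.author a ≠ i) :
    s.pos i (s.remote i a + 1) = a + 1 := by
  have h1 := remote_succ_of_ne h
  have h2 := pos_le h1.ge
  have := (lt_pos_iff (s := s) (i := i) (a := a) h1.ge).2 (by omega)
  omega

/-- The next remote operation exists if more of them have been sent than received. -/
theorem exists_next {i : Fin n} {r A : ℕ} (h : r < s.remote i A) :
    ∃ a, s.pos i (r + 1) = a + 1 ∧ a < A ∧ s.author a ≠ i ∧ s.remote i a = r := by
  have h1 := pos_le (s := s) (i := i) (r := r + 1) (a := A) h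
  have h2 := remote_pos (s := s) (i := i) (r := r + 1) (a := A) h
  obtain hp | ⟨k, hk⟩ : s.pos i (r + 1) = 0 ∨ ∃ k, s.pos i (r + 1) = k + 1 := by
    cases s.pos i (r + 1) <;> simp
  · rw [hp] at h2; simp [remote] at h2
  · have h3 := (lt_pos_iff (s := s) (i := i) (r := r + 1) (a := k) (b := A) h).1 (by omega)
    have h4 : s.author k ≠ i := by
      intro h'
      rw [hk, remote_succ_self h'] at h2
      omega
    rw [hk, remote_succ_of_ne h4] at h2
    exact ⟨k, hk, by omega, h4, by omega⟩

/-- Between two vertices with the same number of remote operations there are only local ones. -/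
theorem author_eq_of_remote_eq {i : Fin n} {a t c : ℕ} (h : s.remote i a = s.remote i c)
    (hat : a ≤ t) (htc : t < c) : s.author t = i := by
  by_contra hne
  have h1 := remote_succ_of_ne hne
  have h2 := remote_mono (s := s) i hat
  have h3 := remote_mono (s := s) i (show t + 1 ≤ c from htc)
  omega

theorem vtx_clock (i : Fin n) (a : ℕ) : s.vtx i a (s.clock a i) = clockSet (s.clock a) := by
  simp [vtx]

theorem vtx_succ_self {i : Fin n} {a : ℕ} (b : ℕ) (h : s.author a = i) :
    s.vtx i (a + 1) b = s.vtx i a b := by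
  subst h; simp [vtx, clock_succ]

theorem insert_oid_vtx {i : Fin n} {a : ℕ} (b : ℕ) (h : s.author a ≠ i) :
    insert (s.oid a) (s.vtx i a b) = s.vtx i (a + 1) b := by
  have := insert_clockSet (Function.update (s.clock a) i b) (s.author a)
  rw [Function.update_of_ne h] at this
  rw [oid, vtx, this, vtx, clock_succ, Function.update_comm h]

theorem insert_oid_clockSet (a : ℕ) :
    insert (s.oid a) (clockSet (s.clock a)) = clockSet (s.clock (a + 1)) := by
  rw [oid, insert_clockSet, clock_succ]

theorem insert_vtx (i : Fin n) (a b : ℕ) :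
    insert (i, b + 1) (s.vtx i a b) = s.vtx i a (b + 1) := by
  have := insert_clockSet (Function.update (s.clock a) i b) i
  simpa [vtx] using this

theorem oid_mem_clockSet {a c : ℕ} (h : a < c) : s.oid a ∈ clockSet (s.clock c) := by
  rw [mem_clockSet]
  refine ⟨Nat.succ_pos _, ?_⟩
  have := clock_mono (s := s) (show a + 1 ≤ c from h) (s.author a)
  rwa [clock_succ_self rfl] at this

theorem oid_notMem_clockSet {a c : ℕ} (h : c ≤ a) : s.oid a ∉ clockSet (s.clock c) := by
  intro hx
  have h1 := (mem_clockSet.1 hx).2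
  have h2 := clock_mono (s := s) h (s.author a)
  exact absurd (h1.trans h2) (Nat.not_succ_le_self _)

theorem oid_notMem_vtx {i : Fin n} {a : ℕ} (b : ℕ) (h : s.author a ≠ i) :
    s.oid a ∉ s.vtx i a b := by
  intro hx
  have h1 := (mem_clockSet.1 hx).2
  simp [oid, h] at h1

variable (s) (ot : ListOp U → ListOp U → ListOp U)

/-- `o` transformed with the local operations number `b₀`, `b₀ + 1`, …, `b₀ + k - 1`, which have the
forms `row`. -/
def alongRow (row : ℕ → ListOp U) (o : ListOp U) (b₀ : ℕ) : ℕ → ListOp U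
  | 0 => o
  | k + 1 => ot (alongRow row o b₀ k) (row (b₀ + k))

/-- The form that the operation number `b` of client `i` takes at the vertex `vtx i a b`, where `a`
is at least the index of its context. -/
noncomputable def locForm : ℕ → Fin n → ℕ → ListOp U
  | 0, i, b => s.orig i b
  -- The form in the context is the original operation; the values below it are irrelevant.
  | a + 1, i, b =>
      if a + 1 ≤ s.ctxIdx i b then s.orig i b
      else if s.author a = i then locForm a i b
      else ot (locForm a i b)
        (alongRow ot (fun c => locForm a i c)
          (locForm a (s.author a) (s.clock a (s.author a))) (s.clock a i) (b - s.clock a i))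

/-- The form in which the server executes its operation number `a`. -/
noncomputable def serverForm (a : ℕ) : ListOp U :=
  s.locForm ot a (s.author a) (s.clock a (s.author a))

/-- The form that the operation number `a` of the server takes at the vertex `vtx i a b`, where this
vertex does not contain the operation. -/
noncomputable def globForm (a : ℕ) (i : Fin n) (b : ℕ) : ListOp U :=
  alongRow ot (s.locForm ot a i) (s.serverForm ot a) (s.clock a i) (b - s.clock a i)

variable {s ot}

theorem locForm_ctxIdx {a : ℕ} {i : Fin n} {b : ℕ} (h : a = s.ctxIdx i b) :
    s.locForm ot a i b = s.orig i b := by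
  cases a with
  | zero => rw [locForm]
  | succ a => rw [locForm, if_pos h.le]

theorem locForm_succ_self {a : ℕ} {i : Fin n} {b : ℕ} (h : s.ctxIdx i b ≤ a)
    (hi : s.author a = i) : s.locForm ot (a + 1) i b = s.locForm ot a i b := by
  rw [locForm, if_neg (by omega), if_pos hi]

theorem locForm_succ_of_ne {a : ℕ} {i : Fin n} {b : ℕ} (h : s.ctxIdx i b ≤ a)
    (hi : s.author a ≠ i) :
    s.locForm ot (a + 1) i b = ot (s.locForm ot a i b) (s.globForm ot a i b) := by
  rw [locForm, if_neg (by omega), if_neg hi]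
  rfl

theorem globForm_clock (a : ℕ) (i : Fin n) :
    s.globForm ot a i (s.clock a i) = s.serverForm ot a := by
  simp [globForm, alongRow]

theorem globForm_succ {a : ℕ} {i : Fin n} {b : ℕ} (h : s.clock a i ≤ b) :
    s.globForm ot a i (b + 1) = ot (s.globForm ot a i b) (s.locForm ot a i b) := by
  rw [globForm, Nat.succ_sub h, alongRow, Nat.add_sub_cancel' h]
  rfl

end Sched

/-! ### The common behavior of the protocols -/

/-- The abstract state of a replica: the number `recv` of operations that it has received, the
number `gen` of operations that it has generated, and the operations that it has executed. -/
structure LocalState (U : Type u) : Type u where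
  recv : ℕ
  gen : ℕ
  ops : List (ListOp U)

/-- The abstract global state of the system. -/
abbrev GlobalState (n : ℕ) (U : Type u) : Type u := Replica n → LocalState U

/-- The abstract initial state. -/
def initialState (n : ℕ) (U : Type u) : GlobalState n U := fun _ => ⟨0, 0, []⟩

namespace Sched

variable (s : Sched n U) (ot : ListOp U → ListOp U → ListOp U) (l₀ : List U)

/-- The abstract effect of an event on the replica at which it occurs. -/
noncomputable def next (l : LocalState U) : Event n U → LocalState U
  | .gen _ o => ⟨l.recv, l.gen + 1, l.ops ++ [o]⟩
  | .serverRecv _ => ⟨l.recv + 1, l.gen, l.ops ++ [s.serverForm ot l.recv]⟩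
  | .clientRecv i =>
      ⟨l.recv + 1, l.gen, l.ops ++ [s.globForm ot (s.pos i (l.recv + 1) - 1) i l.gen]⟩

/-- The event recorded in a state transition that starts in `l` and ends with the operations
`ops`. -/
noncomputable def record (l : LocalState U) (ops : List (ListOp U)) : Event n U → LocalEvent n U
  | .gen _ o => .doOp o (content l₀ ops)
  | .serverRecv _ => .receive (s.oid l.recv)
  | .clientRecv i => .receive (s.oid (s.pos i (l.recv + 1) - 1))

/-- The state transition caused by an event. -/
noncomputable def transition (l : LocalState U) (e : Event n U) : Transition n U :=
  ⟨l.ops, s.record l₀ l (s.next ot l e).ops e, (s.next ot l e).ops,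
    content l₀ (s.next ot l e).ops⟩

/-- The abstract global state after an event. -/
noncomputable def globalNext (st : GlobalState n U) (e : Event n U) : GlobalState n U :=
  Function.update st e.replica (s.next ot (st e.replica) e)

/-- The state transitions of a single replica. -/
noncomputable def localRun : LocalState U → List (Event n U) → List (Transition n U)
  | _, [] => []
  | l, e :: es => s.transition ot l₀ l e :: localRun (s.next ot l e) es

/-- The state transitions of all replicas. -/
noncomputable def run : GlobalState n U → List (Event n U) → List (Replica n × Transition n U)
  | _, [] => []
  | st, e :: es =>
      (e.replica, s.transition ot l₀ (st e.replica) e) :: run (s.globalNext ot st e) es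

/-- The schedule allows the event `e` in the state `st`. -/
def Enabled (st : GlobalState n U) : Event n U → Prop
  | .gen i o => s.orig i (st (.client i)).gen = o ∧
      s.known i (st (.client i)).gen = (st (.client i)).recv
  | .serverRecv i => s.author (st .server).recv = i ∧
      s.clock (st .server).recv i < (st (.client i)).gen
  | .clientRecv i => (st (.client i)).recv < s.remote i (st .server).recv

/-- The schedule allows the events one after the other. -/
def Follows : GlobalState n U → List (Event n U) → Prop
  | _, [] => True
  | st, e :: es => s.Enabled st e ∧ Follows (s.globalNext ot st e) es

/-- The part of `Enabled` that concerns a single replica. -/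
def LocallyEnabled (l : LocalState U) : Event n U → Prop
  | .gen i o => s.orig i l.gen = o ∧ s.known i l.gen = l.recv
  | .serverRecv i => s.author l.recv = i
  | .clientRecv _ => True

/-- The schedule allows the events of a single replica one after the other. -/
def LocallyFollows : LocalState U → List (Event n U) → Prop
  | _, [] => True
  | l, e :: es => s.LocallyEnabled l e ∧ LocallyFollows (s.next ot l e) es

variable {s ot l₀}

theorem run_filter (R : Replica n) (es : List (Event n U)) (st : GlobalState n U) :
    ((s.run ot l₀ st es).filter fun t => t.1 = R).map Prod.snd =
      s.localRun ot l₀ (st R) (eventsAt es R) := by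
  induction es generalizing st with
  | nil => rfl
  | cons e es ih =>
    by_cases h : e.replica = R
    · subst h
      simpa [run, eventsAt, localRun, globalNext] using ih (s.globalNext ot st e)
    · have := ih (s.globalNext ot st e)
      simpa [run, eventsAt, globalNext, h, Function.update_of_ne (Ne.symm h)] using this

theorem Follows.locally {es : List (Event n U)} {st : GlobalState n U} (h : s.Follows ot st es)
    (R : Replica n) : s.LocallyFollows ot (st R) (eventsAt es R) := by
  induction es generalizing st with
  | nil => trivial
  | cons e es ih =>
    have h2 := ih h.2
    by_cases hR : e.replica = R
    · subst hR
      simp only [eventsAt, List.filter_cons, decide_true, if_true]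
      refine ⟨?_, by simpa [globalNext, eventsAt] using h2⟩
      have h1 := h.1
      cases e with
      | gen i o => exact h1
      | serverRecv i => exact h1.1
      | clientRecv i => trivial
    · simpa [globalNext, eventsAt, hR, Function.update_of_ne (Ne.symm hR)] using h2

theorem localRun_prefix {es es' : List (Event n U)} (h : es <+: es') (l : LocalState U) :
    s.localRun ot l₀ l es <+: s.localRun ot l₀ l es' := by
  induction es generalizing l es' with
  | nil => exact List.nil_prefix
  | cons e es ih =>
    obtain ⟨t, rfl⟩ := h
    exact List.cons_prefix_cons.2 ⟨rfl, ih (List.prefix_append es t) _⟩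

/-- A client cannot have received more operations than it knows when it generates its next
operation. -/
theorem LocallyFollows.recv_le_known {i : Fin n} {es : List (Event n U)} {l : LocalState U}
    (h : s.LocallyFollows ot l es) (hR : ∀ e ∈ es, e.replica = Replica.client i)
    (hg : generated i es ≠ []) : l.recv ≤ s.known i l.gen := by
  induction es generalizing l with
  | nil => exact absurd rfl hg
  | cons e es ih =>
    have hR' := fun e' he' => hR e' (List.mem_cons_of_mem _ he')
    have he := hR e List.mem_cons_self
    cases e with
    | gen j o =>
      obtain rfl : j = i := by simpa [Event.replica] using he
      exact h.1.2.ge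
    | serverRecv j => simp [Event.replica] at he
    | clientRecv j =>
      have := ih h.2 hR' (by simpa [generated] using hg)
      exact (Nat.le_succ _).trans this

/-- Two sequences of events of a replica that follow the same schedule and contain equally many
invocations differ only in the number of the messages received at the end. -/
theorem LocallyFollows.comparable {R : Replica n} {es es' : List (Event n U)} {l : LocalState U}
    (h : s.LocallyFollows ot l es) (h' : s.LocallyFollows ot l es')
    (hR : ∀ e ∈ es, e.replica = R) (hR' : ∀ e ∈ es', e.replica = R)
    (hg : ∀ i, (generated i es).length = (generated i es').length) :
    es <+: es' ∨ es' <+: es := by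
  induction es generalizing l es' with
  | nil => exact .inl List.nil_prefix
  | cons e es ih =>
    cases es' with
    | nil => exact .inr List.nil_prefix
    | cons e' es' =>
      have aux : e = e' → e :: es <+: e' :: es' ∨ e' :: es' <+: e :: es := by
        rintro rfl
        have := ih h.2 h'.2 (fun x hx => hR x (List.mem_cons_of_mem _ hx))
          (fun x hx => hR' x (List.mem_cons_of_mem _ hx)) (fun i => by
            have := hg i
            simp only [generated, List.filterMap_cons] at this ⊢
            split at this <;> simpa using this)
        simpa [List.cons_prefix_cons] using this
      -- One sequence cannot continue with a receipt where the other one continues with an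
      -- invocation.
      have hne : ∀ (i : Fin n) (o : ListOp U) (fs fs' : List (Event n U)),
          s.LocallyFollows ot l (.gen i o :: fs) → s.LocallyFollows ot l (.clientRecv i :: fs') →
          (∀ x ∈ Event.clientRecv i :: fs', x.replica = Replica.client i) →
          (generated i (.gen i o :: fs)).length =
            (generated i (Event.clientRecv i :: fs')).length → False := by
        intro i o fs fs' hf hf' hr hlen
        have h1 := LocallyFollows.recv_le_known (i := i) hf'.2
          (fun x hx => hr x (List.mem_cons_of_mem _ hx)) (by
            intro h0
            simp only [generated, List.filterMap_cons] at h0 hlen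
            rw [h0] at hlen
            simp at hlen)
        have h2 := hf.1.2
        simp only [next] at h1
        omega
      have he := hR e List.mem_cons_self
      have he' := hR' e' List.mem_cons_self
      subst he
      cases e <;> cases e' <;> simp only [Event.replica, Replica.client.injEq, reduceCtorEq] at he'
      case gen.gen i o j o' =>
        subst he'
        exact aux (by rw [← h.1.1, ← h'.1.1])
      case gen.clientRecv i o j =>
        subst he'
        exact (hne _ _ _ _ h h' hR' (hg _)).elim
      case serverRecv.serverRecv i j =>
        exact aux (by rw [← show _ = i from h.1, ← show _ = j from h'.1])
      case clientRecv.gen i j o =>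
        subst he'
        exact (hne _ _ _ _ h' h hR (hg _).symm).elim
      case clientRecv.clientRecv i j =>
        exact aux (by rw [he'])

variable (s) in
/-- The operation number `a` of the server has been generated in a context that precedes it in the
order of the server and that contains the contexts of the earlier operations of its author. -/
def Causal (a : ℕ) : Prop :=
  s.ctxIdx (s.author a) (s.clock a (s.author a)) ≤ a ∧
    ∀ c < s.clock a (s.author a),
      s.ctxIdx (s.author a) c ≤ s.ctxIdx (s.author a) (s.clock a (s.author a))

variable (s) in
/-- Properties of the states that are reached by following the schedule. -/
structure Reachable (st : GlobalState n U) : Prop where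
  clock_le (i : Fin n) : s.clock (st .server).recv i ≤ (st (.client i)).gen
  recv_le (i : Fin n) : (st (.client i)).recv ≤ s.remote i (st .server).recv
  known_le (i : Fin n) (b : ℕ) (h : b < (st (.client i)).gen) :
    s.known i b ≤ (st (.client i)).recv
  known_mono (i : Fin n) (b b' : ℕ) (h : b ≤ b') (h' : b' < (st (.client i)).gen) :
    s.known i b ≤ s.known i b'
  causal (a : ℕ) (h : a < (st .server).recv) : s.Causal a

theorem reachable_initial : s.Reachable (initialState n U) := by
  constructor <;> simp [initialState, clock]

theorem Reachable.ctxIdx_le {st : GlobalState n U} (h : s.Reachable st) {i : Fin n} {b : ℕ}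
    (hb : b < (st (.client i)).gen) : s.ctxIdx i b ≤ s.pos i (st (.client i)).recv :=
  pos_mono (h.known_le i b hb) (h.recv_le i)

theorem Reachable.pos_le {st : GlobalState n U} (h : s.Reachable st) (i : Fin n) :
    s.pos i (st (.client i)).recv ≤ (st .server).recv :=
  Sched.pos_le (h.recv_le i)

theorem Reachable.ctxIdx_mono {st : GlobalState n U} (h : s.Reachable st) {i : Fin n} {b b' : ℕ}
    (hb : b ≤ b') (hb' : b' < (st (.client i)).gen) : s.ctxIdx i b ≤ s.ctxIdx i b' :=
  pos_mono (h.known_mono i b b' hb hb') ((h.known_le i b' hb').trans (h.recv_le i))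

theorem Reachable.causal_recv {st : GlobalState n U} (h : s.Reachable st)
    (hlt : s.clock (st .server).recv (s.author (st .server).recv) <
      (st (.client (s.author (st .server).recv))).gen) : s.Causal (st .server).recv :=
  ⟨(h.ctxIdx_le hlt).trans (h.pos_le _), fun _ hc => h.ctxIdx_mono hc.le hlt⟩

theorem Reachable.next {st : GlobalState n U} {e : Event n U} (h : s.Reachable st)
    (he : s.Enabled st e) : s.Reachable (s.globalNext ot st e) := by
  cases e with
  | gen i o =>
    have hS : s.globalNext ot st (.gen i o) .server = st .server := by
      simp [globalNext, Event.replica]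
    have hi : s.globalNext ot st (.gen i o) (.client i) =
        s.next ot (st (.client i)) (.gen i o) := by
      simp [globalNext, Event.replica]
    have hj : ∀ j ≠ i, s.globalNext ot st (.gen i o) (.client j) = st (.client j) := by
      intro j hj
      simp [globalNext, Event.replica, hj]
    constructor
    · intro j
      have := h.clock_le j
      by_cases hji : j = i
      · subst hji; rw [hS, hi]; exact this.trans (Nat.le_succ _)
      · rwa [hS, hj j hji]
    · intro j
      have := h.recv_le j
      by_cases hji : j = i
      · subst hji; rw [hS, hi]; exact this
      · rwa [hS, hj j hji]
    · intro j b
      by_cases hji : j = i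
      · subst hji; rw [hi]
        intro hb
        rcases Nat.lt_succ_iff_lt_or_eq.1 hb with hb | rfl
        · exact h.known_le j b hb
        · exact he.2.le
      · rw [hj j hji]; exact h.known_le j b
    · intro j b b' hbb
      by_cases hji : j = i
      · subst hji; rw [hi]
        intro hb
        rcases Nat.lt_succ_iff_lt_or_eq.1 hb with hb | rfl
        · exact h.known_mono j b b' hbb hb
        · rcases hbb.lt_or_eq with hlt | rfl
          · rw [he.2]; exact h.known_le j b hlt
          · exact le_rfl
      · rw [hj j hji]; exact h.known_mono j b b' hbb
    · rw [hS]; exact h.causal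
  | serverRecv i =>
    have hS : s.globalNext ot st (.serverRecv i) .server =
        s.next ot (st .server) (.serverRecv i) := by
      simp [globalNext, Event.replica]
    have hj : ∀ j, s.globalNext ot st (.serverRecv i) (.client j) = st (.client j) := by
      intro j
      simp [globalNext, Event.replica]
    constructor
    · intro j
      rw [hS, hj]
      simp only [Sched.next]
      by_cases hji : s.author (st .server).recv = j
      · rw [clock_succ_self hji]
        obtain rfl : i = j := he.1.symm.trans hji
        exact he.2
      · rw [clock_succ_of_ne hji]; exact h.clock_le j
    · intro j
      rw [hS, hj]
      exact (h.recv_le j).trans (remote_mono j (Nat.le_succ _))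
    · intro j; rw [hj]; exact h.known_le j
    · intro j; rw [hj]; exact h.known_mono j
    · rw [hS]
      intro a ha
      rcases Nat.lt_succ_iff_lt_or_eq.1 ha with ha | rfl
      · exact h.causal a ha
      · obtain ⟨rfl, hlt⟩ := he
        exact h.causal_recv hlt
  | clientRecv i =>
    have hS : s.globalNext ot st (.clientRecv i) .server = st .server := by
      simp [globalNext, Event.replica]
    have hi : s.globalNext ot st (.clientRecv i) (.client i) =
        s.next ot (st (.client i)) (.clientRecv i) := by
      simp [globalNext, Event.replica]
    have hj : ∀ j ≠ i, s.globalNext ot st (.clientRecv i) (.client j) = st (.client j) := by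
      intro j hj
      simp [globalNext, Event.replica, hj]
    have hg : ∀ j, (s.globalNext ot st (.clientRecv i) (.client j)).gen = (st (.client j)).gen := by
      intro j
      by_cases hji : j = i
      · subst hji; rw [hi]; rfl
      · rw [hj j hji]
    constructor
    · intro j; rw [hS, hg]; exact h.clock_le j
    · intro j
      by_cases hji : j = i
      · subst hji; rw [hS, hi]; exact he
      · rw [hS, hj j hji]; exact h.recv_le j
    · intro j b
      rw [hg]
      intro hb
      by_cases hji : j = i
      · subst hji; rw [hi]; exact (h.known_le j b hb).trans (Nat.le_succ _)
      · rw [hj j hji]; exact h.known_le j b hb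
    · intro j; simp only [hg]; exact h.known_mono j
    · rw [hS]; exact h.causal

end Sched

/-! ### The contents of the channels -/

namespace Sched

variable (s : Sched n U)

/-- The messages under way from client `i` to the server, if `msg b` carries the operation number
`b` of `i`, of which `g` have been sent and `k` received. -/
def upChannel {M : Type u} (msg : ℕ → M) (g k : ℕ) : List M := ((List.range g).drop k).map msg

/-- The messages under way from the server to client `i`, if `msg a` carries the operation number
`a` of the server, which has executed `A` operations, and if `i` has received `r` messages. -/
def downChannel {M : Type u} (msg : ℕ → M) (i : Fin n) (A r : ℕ) : List M :=
  (((List.range A).filter fun a => s.author a ≠ i).drop r).map msg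

variable {s}

theorem upChannel_self {M : Type u} (msg : ℕ → M) (g : ℕ) : upChannel msg g g = [] := by
  simp [upChannel]

theorem upChannel_succ {M : Type u} (msg : ℕ → M) {g k : ℕ} (h : k ≤ g) :
    upChannel msg (g + 1) k = upChannel msg g k ++ [msg g] := by
  rw [upChannel, List.range_succ, List.drop_append_of_le_length (by simpa using h)]
  simp [upChannel]

theorem upChannel_cons {M : Type u} (msg : ℕ → M) {g k : ℕ} (h : k < g) :
    upChannel msg g k = msg k :: upChannel msg g (k + 1) := by
  rw [upChannel, List.drop_eq_getElem_cons (by simpa using h)]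
  simp [upChannel]

theorem length_filter_author (i : Fin n) (A : ℕ) :
    ((List.range A).filter fun a => s.author a ≠ i).length = s.remote i A := by
  rw [remote, Nat.count_eq_card_filter_range, ← List.countP_eq_length_filter]
  rw [← Nat.count_eq_card_filter_range, Nat.count]

theorem downChannel_succ_self {M : Type u} (msg : ℕ → M) {i : Fin n} {A : ℕ} (r : ℕ)
    (h : s.author A = i) : s.downChannel msg i (A + 1) r = s.downChannel msg i A r := by
  simp [downChannel, List.range_succ, h]

theorem downChannel_succ_of_ne {M : Type u} (msg : ℕ → M) {i : Fin n} {A r : ℕ}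
    (h : s.author A ≠ i) (hr : r ≤ s.remote i A) :
    s.downChannel msg i (A + 1) r = s.downChannel msg i A r ++ [msg A] := by
  rw [downChannel, List.range_succ, List.filter_append, List.drop_append_of_le_length
    (by rwa [length_filter_author])]
  simp [downChannel, h]

theorem downChannel_cons {M : Type u} (msg : ℕ → M) {i : Fin n} {A a : ℕ}
    (ha : a < A) (h : s.author a ≠ i) :
    s.downChannel msg i A (s.remote i a) =
      msg a :: s.downChannel msg i A (s.remote i a + 1) := by
  induction A, ha using Nat.le_induction with
  | base =>
    have h1 := length_filter_author (s := s) i a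
    rw [downChannel_succ_of_ne _ h le_rfl, downChannel, downChannel,
      List.drop_of_length_le h1.le, List.drop_of_length_le]
    · rfl
    · rw [length_filter_author, remote_succ_of_ne h]
  | succ A hA ih =>
    by_cases hA' : s.author A = i
    · rw [downChannel_succ_self _ _ hA', downChannel_succ_self _ _ hA', ih]
    · have h1 := remote_mono (s := s) i hA
      rw [Nat.succ_eq_add_one, remote_succ_of_ne h] at h1
      rw [downChannel_succ_of_ne _ hA' (by omega), downChannel_succ_of_ne _ hA' h1, ih]
      rfl

/-! ### Protocols that realize the schedule -/

variable (s) (ot : ListOp U → ListOp U → ListOp U)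

/-- The protocol `P` behaves as the schedule determines.  `Client i a b C` relates the local state
`C` of client `i` to the vertex `vtx i a b`, and `Server a S` relates the state `S` of the server to
its first `a` operations.  When client `i` receives the operation number `a'`, the server may have
received operations of `i` between the last one known to `i` and this one, hence the `hown` in
`clientReceive`. -/
structure Realization (P : Protocol n U) where
  upMsg : Fin n → ℕ → P.Msg
  downMsg : ℕ → P.Msg
  Client : Fin n → ℕ → ℕ → P.Client → Prop
  Server : ℕ → P.Server → Prop
  client₀ (i : Fin n) : Client i 0 0 (P.client₀ i) ∧ P.clientState (P.client₀ i) = []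
  server₀ : Server 0 P.server₀ ∧ P.serverState P.server₀ = []
  msgOid_up (i : Fin n) (b : ℕ) : P.msgOid (upMsg i b) = (i, b + 1)
  msgOid_down (a : ℕ) : P.msgOid (downMsg a) = s.oid a
  clientDo {i : Fin n} {a b : ℕ} {C : P.Client} (h : Client i a b C) (ha : a = s.ctxIdx i b) :
    ∃ C', P.clientDo C (s.orig i b) = (C', upMsg i b) ∧ Client i a (b + 1) C' ∧
      P.clientState C' = P.clientState C ++ [s.orig i b]
  clientReceive {i : Fin n} {a a' b : ℕ} {C : P.Client} (h : Client i a b C) (ha : a ≤ a')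
    (hown : ∀ t, a ≤ t → t < a' → s.author t = i) (hi : s.author a' ≠ i)
    (hb : s.clock a' i ≤ b) (hctx : ∀ c < b, s.ctxIdx i c ≤ a) (hcausal : s.Causal a') :
    ∃ C', P.clientReceive C (downMsg a') = some C' ∧ Client i (a' + 1) b C' ∧
      P.clientState C' = P.clientState C ++ [s.globForm ot a' i b]
  serverReceive {a : ℕ} {S : P.Server} (h : Server a S) (hcausal : s.Causal a) :
    ∃ S', P.serverReceive S (upMsg (s.author a) (s.clock a (s.author a))) =
        some (S', fun j => if j = s.author a then none else some (downMsg a)) ∧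
      Server (a + 1) S' ∧ P.serverState S' = P.serverState S ++ [s.serverForm ot a]

variable {s ot}

/-- The global state of a protocol that corresponds to an abstract state. -/
structure Realization.Corresponds {P : Protocol n U} (r : s.Realization ot P)
    (st : GlobalState n U) (c : P.Config) : Prop where
  client (i : Fin n) :
    r.Client i (s.pos i (st (.client i)).recv) (st (.client i)).gen (c.clients i)
  clientState (i : Fin n) : P.clientState (c.clients i) = (st (.client i)).ops
  server : r.Server (st .server).recv c.server
  serverState : P.serverState c.server = (st .server).ops
  toServer (i : Fin n) : c.toServer i =
    upChannel (r.upMsg i) (st (.client i)).gen (s.clock (st .server).recv i)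
  toClient (i : Fin n) : c.toClient i =
    s.downChannel r.downMsg i (st .server).recv (st (.client i)).recv

theorem Realization.corresponds_initial {P : Protocol n U} (r : s.Realization ot P) :
    r.Corresponds (initialState n U) P.config₀ where
  client i := by simpa [initialState, Protocol.config₀] using (r.client₀ i).1
  clientState i := (r.client₀ i).2
  server := r.server₀.1
  serverState := r.server₀.2
  toServer i := by simp only [initialState, clock_zero, upChannel_self]; rfl
  toClient i := by simp only [initialState]; rfl

theorem Realization.Corresponds.step {P : Protocol n U} {r : s.Realization ot P} {l₀ : List U}
    {st : GlobalState n U} {c : P.Config} {e : Event n U} (hc : r.Corresponds st c)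
    (hst : s.Reachable st) (he : s.Enabled st e) :
    ∃ c', P.step l₀ c e = some (c', s.transition ot l₀ (st e.replica) e) ∧
      r.Corresponds (s.globalNext ot st e) c' := by
  cases e with
  | gen i o =>
    obtain ⟨rfl, hk⟩ := he
    obtain ⟨C', h1, h2, h3⟩ := r.clientDo (hc.client i) (by rw [ctxIdx, hk])
    refine ⟨{ c with
      clients := Function.update c.clients i C'
      toServer := Function.update c.toServer i
        (c.toServer i ++ [r.upMsg i (st (.client i)).gen]) }, ?_, ?_⟩
    · simp only [Protocol.step, h1, h3, hc.clientState]
      rfl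
    · have hS : s.globalNext ot st (.gen i (s.orig i (st (.client i)).gen)) .server =
          st .server := by
        simp [globalNext, Event.replica]
      have hi : s.globalNext ot st (.gen i (s.orig i (st (.client i)).gen)) (.client i) =
          ⟨(st (.client i)).recv, (st (.client i)).gen + 1,
            (st (.client i)).ops ++ [s.orig i (st (.client i)).gen]⟩ := by
        simp [globalNext, Event.replica, Sched.next]
      have hj : ∀ j ≠ i, s.globalNext ot st (.gen i (s.orig i (st (.client i)).gen)) (.client j) =
          st (.client j) := by
        intro j hj
        simp [globalNext, Event.replica, hj]
      constructor
      · intro j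
        by_cases hji : j = i
        · subst hji; rw [hi]; simpa using h2
        · rw [hj j hji]; simpa [hji] using hc.client j
      · intro j
        by_cases hji : j = i
        · subst hji; rw [hi]; simpa [hc.clientState] using h3
        · rw [hj j hji]; simpa [hji] using hc.clientState j
      · rw [hS]; exact hc.server
      · rw [hS]; exact hc.serverState
      · intro j
        rw [hS]
        by_cases hji : j = i
        · subst hji
          rw [hi, upChannel_succ _ (hst.clock_le j)]
          simp [hc.toServer]
        · rw [hj j hji]; simpa [hji] using hc.toServer j
      · intro j
        rw [hS, show c.toClient j = _ from hc.toClient j]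
        by_cases hji : j = i
        · subst hji; rw [hi]
        · rw [hj j hji]
  | serverRecv i =>
    obtain ⟨rfl, hlt⟩ := he
    obtain ⟨S', h1, h2, h3⟩ := r.serverReceive hc.server (hst.causal_recv hlt)
    set A := (st .server).recv with hA
    set i := s.author A with hi
    have hch := hc.toServer i
    rw [← hA, upChannel_cons _ hlt] at hch
    refine ⟨{ c with
      server := S'
      toServer := Function.update c.toServer i
        (upChannel (r.upMsg i) (st (.client i)).gen (s.clock A i + 1))
      toClient := fun j => c.toClient j ++
        (if j = i then none else some (r.downMsg A)).toList }, ?_, ?_⟩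
    · simp only [Protocol.step, hch, h1, Option.map_some, h3, hc.serverState, r.msgOid_up]
      rfl
    · have hS : s.globalNext ot st (.serverRecv i) .server =
          ⟨A + 1, (st .server).gen, (st .server).ops ++ [s.serverForm ot A]⟩ := by
        simp [globalNext, Event.replica, Sched.next, hA]
      have hC : ∀ j, s.globalNext ot st (.serverRecv i) (.client j) = st (.client j) := by
        intro j; simp [globalNext, Event.replica]
      constructor
      · intro j; rw [hC]; exact hc.client j
      · intro j; rw [hC]; exact hc.clientState j
      · rw [hS]; exact h2
      · rw [hS, h3, hc.serverState]
      · intro j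
        rw [hS, hC]
        by_cases hji : j = i
        · subst hji
          rw [clock_succ_self hi.symm]
          simp
        · rw [clock_succ_of_ne (Ne.symm hji)]
          simpa [hji] using hc.toServer j
      · intro j
        rw [hS, hC]
        by_cases hji : j = i
        · subst hji
          rw [downChannel_succ_self _ _ hi.symm]
          simpa using hc.toClient i
        · rw [downChannel_succ_of_ne _ (Ne.symm hji) (hst.recv_le j)]
          simp [hji, hc.toClient, hA]
  | clientRecv i =>
    obtain ⟨a, hpos, haA, hai, hrem⟩ := exists_next he
    have hrem' : s.remote i (s.pos i (st (.client i)).recv) = (st (.client i)).recv :=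
      remote_pos (hst.recv_le i)
    obtain ⟨C', h1, h2, h3⟩ := r.clientReceive (hc.client i) (Sched.pos_le hrem.ge)
      (fun t ht ht' => author_eq_of_remote_eq (hrem'.trans hrem.symm) ht ht') hai
      ((clock_mono haA.le i).trans (hst.clock_le i)) (fun b hb => hst.ctxIdx_le hb)
      (hst.causal a haA)
    have hch := hc.toClient i
    rw [← hrem, downChannel_cons _ haA hai] at hch
    refine ⟨{ c with
      clients := Function.update c.clients i C'
      toClient := Function.update c.toClient i
        (s.downChannel r.downMsg i (st .server).recv (s.remote i a + 1)) }, ?_, ?_⟩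
    · simp only [Protocol.step, hch, h1, Option.map_some, h3, hc.clientState, r.msgOid_down]
      simp [transition, Event.replica, Sched.next, record, hpos]
    · have hS : s.globalNext ot st (.clientRecv i) .server = st .server := by
        simp [globalNext, Event.replica]
      have hi : s.globalNext ot st (.clientRecv i) (.client i) =
          ⟨(st (.client i)).recv + 1, (st (.client i)).gen,
            (st (.client i)).ops ++ [s.globForm ot a i (st (.client i)).gen]⟩ := by
        simp [globalNext, Event.replica, Sched.next, hpos]
      have hj : ∀ j ≠ i, s.globalNext ot st (.clientRecv i) (.client j) = st (.client j) := by
        intro j hj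
        simp [globalNext, Event.replica, hj]
      constructor
      · intro j
        by_cases hji : j = i
        · subst hji; rw [hi]; simpa [hpos] using h2
        · rw [hj j hji]; simpa [hji] using hc.client j
      · intro j
        by_cases hji : j = i
        · subst hji; rw [hi]; simpa [hc.clientState] using h3
        · rw [hj j hji]; simpa [hji] using hc.clientState j
      · rw [hS]; exact hc.server
      · rw [hS]; exact hc.serverState
      · intro j
        rw [hS, show c.toServer j = _ from hc.toServer j]
        by_cases hji : j = i
        · subst hji; rw [hi]
        · rw [hj j hji]
      · intro j
        rw [hS]
        by_cases hji : j = i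
        · subst hji; rw [hi]; simp [hrem]
        · rw [hj j hji]; simpa [hji] using hc.toClient j

theorem Realization.transitions_eq_run {P : Protocol n U} (r : s.Realization ot P) {l₀ : List U}
    (es : List (Event n U)) {st : GlobalState n U} {c : P.Config} (hst : s.Reachable st)
    (hc : r.Corresponds st c) (hes : s.Follows ot st es) :
    P.transitions l₀ c es = some (s.run ot l₀ st es) := by
  induction es generalizing st c with
  | nil => rfl
  | cons e es ih =>
    obtain ⟨c', h1, h2⟩ := hc.step hst hes.1
    rw [Protocol.transitions, h1, Option.bind_some, ih (hst.next hes.1) h2 hes.2]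
    rfl

/-- The behavior of each replica is determined by the schedule and by the events at the replica. -/
theorem Realization.behavior_eq {P : Protocol n U} (r : s.Realization ot P) (l₀ : List U)
    {α : List (Event n U)} (h : s.Follows ot (initialState n U) α) (R : Replica n) :
    P.behavior l₀ α R = some (s.localRun ot l₀ ⟨0, 0, []⟩ (eventsAt α R)) := by
  rw [Protocol.behavior, r.transitions_eq_run α reachable_initial r.corresponds_initial h,
    Option.map_some, run_filter]
  rfl

end Sched

/-! ### Transformation along a path -/

/-- An edge on the path along which an operation is transformed: its source `src`, the identifier
`oid` and the form `op` of its label, and the form `arg` in which the operation to be transformed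
arrives at `src`. -/
structure PathNode (n : ℕ) (U : Type u) : Type u where
  src : Finset (Oid n)
  oid : Oid n
  op : ListOp U
  arg : ListOp U

/-- The nodes form a path from `w` to `w'` along which the form of the transformed operation changes
from `y` to `y'`. -/
def IsPath (ot : ListOp U → ListOp U → ListOp U) (w' : Finset (Oid n)) (y' : ListOp U) :
    Finset (Oid n) → ListOp U → List (PathNode n U) → Prop
  | w, y, [] => w = w' ∧ y = y'
  | w, y, p :: l => p.src = w ∧ p.arg = y ∧ p.oid ∉ w ∧
      IsPath ot w' y' (insert p.oid w) (ot y p.op) l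

section Path

variable {ot : ListOp U → ListOp U → ListOp U} {w w' w'' : Finset (Oid n)} {y y' y'' : ListOp U}
  {l l' : List (PathNode n U)}

theorem IsPath.append (h : IsPath ot w' y' w y l) (h' : IsPath ot w'' y'' w' y' l') :
    IsPath ot w'' y'' w y (l ++ l') := by
  induction l generalizing w y with
  | nil => obtain ⟨rfl, rfl⟩ := h; exact h'
  | cons p l ih => exact ⟨h.1, h.2.1, h.2.2.1, ih h.2.2.2⟩

theorem IsPath.subset (h : IsPath ot w' y' w y l) : w ⊆ w' := by
  induction l generalizing w y with
  | nil => exact h.1.subset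
  | cons p l ih => exact (Finset.subset_insert _ _).trans (ih h.2.2.2)

theorem IsPath.src_subset (h : IsPath ot w' y' w y l) {p : PathNode n U} (hp : p ∈ l) :
    insert p.oid p.src ⊆ w' ∧ w ⊆ p.src ∧ p.oid ∉ p.src := by
  induction l generalizing w y with
  | nil => simp at hp
  | cons q l ih =>
    rcases List.mem_cons.1 hp with rfl | hp
    · obtain ⟨h1, -, h2, h3⟩ := h
      subst h1
      exact ⟨h3.subset, subset_rfl, h2⟩
    · obtain ⟨h1, h2, h3⟩ := ih h.2.2.2 hp
      exact ⟨h1, (Finset.subset_insert _ _).trans h2, h3⟩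

/-- A path given by functions of an index in `[k, m]`.  The indices outside of `E` stand for no
edge. -/
theorem isPath_of_range (E : ℕ → Prop) [DecidablePred E] (w : ℕ → Finset (Oid n)) (x : ℕ → Oid n)
    (o y : ℕ → ListOp U) {k m : ℕ} (hkm : k ≤ m)
    (hskip : ∀ t, k ≤ t → t < m → ¬ E t → w (t + 1) = w t ∧ y (t + 1) = y t)
    (hstep : ∀ t, k ≤ t → t < m → E t →
      x t ∉ w t ∧ w (t + 1) = insert (x t) (w t) ∧ y (t + 1) = ot (y t) (o t)) :
    IsPath ot (w m) (y m) (w k) (y k)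
      (((List.range' k (m - k)).filter E).map fun t => ⟨w t, x t, o t, y t⟩) := by
  induction hd : m - k generalizing k with
  | zero =>
    obtain rfl : k = m := by omega
    exact ⟨rfl, rfl⟩
  | succ d ih =>
    have := ih (k := k + 1) (by omega) (fun t ht => hskip t (by omega))
      (fun t ht => hstep t (by omega)) (by omega)
    rw [List.range'_succ, List.filter_cons]
    by_cases hE : E k
    · obtain ⟨h1, h2, h3⟩ := hstep k le_rfl (by omega) hE
      rw [h2, h3] at this
      simpa [hE, IsPath, h1] using this
    · obtain ⟨h1, h2⟩ := hskip k le_rfl (by omega) hE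
      rw [h1, h2] at this
      simpa [hE] using this

theorem mem_path_of_range {E : ℕ → Prop} [DecidablePred E] {f : ℕ → PathNode n U} {k m : ℕ}
    {p : PathNode n U} :
    p ∈ ((List.range' k (m - k)).filter E).map f ↔ ∃ t, k ≤ t ∧ t < m ∧ E t ∧ f t = p := by
  simp only [List.mem_map, List.mem_filter, List.mem_range'_1, decide_eq_true_eq]
  constructor
  · rintro ⟨t, ⟨h1, h2⟩, h3⟩
    exact ⟨t, h1.1, by omega, h2, h3⟩
  · rintro ⟨t, h1, h2, h3, h4⟩
    exact ⟨t, ⟨⟨h1, by omega⟩, h3⟩, h4⟩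

/-- Every vertex given by an index in `[k, m]` is the last one or the source of an edge. -/
theorem eq_or_exists_edge {E : ℕ → Prop} {w : ℕ → Finset (Oid n)} {m t : ℕ}
    (htm : t ≤ m) (hskip : ∀ t', t ≤ t' → t' < m → ¬ E t' → w (t' + 1) = w t') :
    w t = w m ∨ ∃ t', t ≤ t' ∧ t' < m ∧ E t' ∧ w t = w t' := by
  induction hd : m - t generalizing t with
  | zero =>
    obtain rfl : t = m := by omega
    exact .inl rfl
  | succ d ih =>
    by_cases hE : E t
    · exact .inr ⟨t, le_rfl, by omega, hE, rfl⟩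
    · have h := hskip t le_rfl (by omega) hE
      rcases ih (t := t + 1) (by omega) (fun t' ht' => hskip t' (by omega)) (by omega) with
        h' | ⟨t', h1, h2, h3, h4⟩
      · exact .inl (h ▸ h')
      · exact .inr ⟨t', by omega, h2, h3, h ▸ h4⟩

end Path

/-! ### Jupiter -/

namespace Jupiter

/-- There is an edge from `u` along the dimension `d` whose label has the identifier `x` and the
form `o`. -/
def Space.HasEdge (S : Space n U) (d : Dim) (u : Finset (Oid n)) (x : Oid n) (o : ListOp U) :
    Prop :=
  ∃ e, S.edge d u = some e ∧ e.op.o = o ∧ e.op.oid = x ∧ e.tgt = insert x u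

section Space

variable {ot : ListOp U → ListOp U → ListOp U} {S : Space n U} {d : Dim}

theorem Dim.other_ne (d : Dim) : d.other ≠ d := by cases d <;> simp [Dim.other]

theorem Space.setEdge_edge_of_ne {d' : Dim} (h : d' ≠ d) (w v : Finset (Oid n)) (op : Op n U) :
    (S.setEdge d' w v op).edge d = S.edge d := by
  simp [Space.setEdge, Function.update_of_ne h.symm]

theorem Space.setEdge_edge_of_ne_src {w u : Finset (Oid n)} (h : u ≠ w) (v : Finset (Oid n))
    (op : Op n U) : (S.setEdge d w v op).edge d u = S.edge d u := by
  simp [Space.setEdge, Function.update_of_ne h]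

theorem Space.append_edge (op : Op n U) :
    (S.append d op).edge = (S.setEdge d S.cur (insert op.oid S.cur) op).edge := rfl

theorem Space.setEdge_edge_self (w v : Finset (Oid n)) (op : Op n U) :
    (S.setEdge d w v op).edge d w = some ⟨op, v⟩ := by
  simp [Space.setEdge]

/-- The loop of `xForm` runs along a path of edges and copies it, with the labels transformed. -/
theorem Space.xFormLoop_eq {z : Oid n} {w' : Finset (Oid n)} {y' : ListOp U} (hz : z ∉ w')
    (l : List (PathNode n U)) {w : Finset (Oid n)} {y : ListOp U} (hl : IsPath ot w' y' w y l)
    {fuel : ℕ} (hfuel : w'.card ≤ fuel + w.card) {S : Space n U} (hcur : S.cur = w')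
    (hedge : ∀ p ∈ l, S.HasEdge d p.src p.oid p.op) (hv : insert z w ∈ S.vertices) :
    ∃ S', Space.xFormLoop ot d fuel S w (insert z w) ⟨y, z, w⟩ = some (S', ⟨y', z, w'⟩) ∧
      S'.cur = insert z w' ∧ S.vertices ⊆ S'.vertices ∧ insert z w' ∈ S'.vertices ∧
      (∀ p ∈ l, insert z p.src ∈ S'.vertices) ∧
      (∀ p ∈ l, S'.HasEdge d (insert z p.src) p.oid (ot p.op p.arg)) ∧
      ∀ u, ¬ insert z w ⊆ u → S'.edge d u = S.edge d u := by
  induction l generalizing w y fuel S with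
  | nil =>
    obtain ⟨rfl, rfl⟩ := hl
    refine ⟨{ S with cur := insert z w }, ?_, rfl, subset_rfl, hv, by simp, by simp,
      fun _ _ => rfl⟩
    rw [Space.xFormLoop.eq_def]
    exact if_pos hcur.symm
  | cons p l ih =>
    obtain ⟨h1, h2, h3, h4⟩ := hl
    subst h1 h2
    have hsub := h4.subset
    have hne : p.src ≠ S.cur := by
      rintro h
      exact h3 (by rw [h, hcur]; exact hsub (Finset.mem_insert_self _ _))
    have hcard := Finset.card_insert_of_notMem h3
    have hcard' := Finset.card_le_card hsub
    obtain ⟨fuel, rfl⟩ : ∃ f, fuel = f + 1 := ⟨fuel - 1, by omega⟩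
    obtain ⟨e, he, he1, he2, he3⟩ := hedge p List.mem_cons_self
    have hzw : z ∉ insert p.oid p.src := fun h => hz (hsub h)
    have hpz : p.oid ≠ z := by rintro rfl; exact hzw (Finset.mem_insert_self _ _)
    have hcomm : insert p.oid (insert z p.src) = insert z (insert p.oid p.src) :=
      Finset.insert_comm _ _ _
    have hpv : p.oid ∉ insert z p.src := by simp [h3, hpz]
    set S₁ := S.setEdge d (insert z p.src) (insert z (insert p.oid p.src))
      (e.op.transform ot ⟨p.arg, z, p.src⟩) with hS₁
    set S₂ := S₁.setEdge d.other (insert p.oid p.src) (insert z (insert p.oid p.src))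
      ⟨ot p.arg p.op, z, insert p.oid p.src⟩ with hS₂
    have hS₂e : S₂.edge d = S₁.edge d := Space.setEdge_edge_of_ne d.other_ne _ _ _
    have hframe : ∀ u, u ≠ insert z p.src → S₂.edge d u = S.edge d u := by
      intro u hu
      rw [hS₂e, hS₁, Space.setEdge_edge_of_ne_src hu]
    obtain ⟨S', g1, g2, g3, g4, g5, g6, g7⟩ := ih (S := S₂) (fuel := fuel) h4 (by omega) hcur
      (by
        intro q hq
        obtain ⟨e', he', hq'⟩ := hedge q (List.mem_cons_of_mem _ hq)
        refine ⟨e', ?_, hq'⟩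
        rw [hframe, he']
        rintro h
        refine hz ((h4.src_subset hq).1 (Finset.mem_insert_of_mem ?_))
        rw [h]
        exact Finset.mem_insert_self _ _)
      (by simp [hS₂, Space.setEdge])
    have hvv : S.vertices ⊆ S₂.vertices := by
      intro u hu
      simp [hS₂, hS₁, Space.setEdge, hu]
    have hnot : ¬ insert z (insert p.oid p.src) ⊆ insert z p.src := by
      intro h
      exact hpv (h (by simp))
    refine ⟨S', ?_, g2, hvv.trans g3, g4, ?_, ?_, ?_⟩
    · rw [Space.xFormLoop.eq_def]
      dsimp only
      rw [if_neg hne]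
      simp only [he, he2, he3, hcomm]
      rw [← g1]
      simp only [Op.transform, he1, he2, hS₂, hS₁]
    · intro q hq
      rcases List.mem_cons.1 hq with rfl | hq
      · exact g3 (hvv hv)
      · exact g5 q hq
    · intro q hq
      rcases List.mem_cons.1 hq with rfl | hq
      · refine ⟨⟨e.op.transform ot ⟨q.arg, z, q.src⟩, insert z (insert q.oid q.src)⟩, ?_, ?_, he2,
          hcomm.symm⟩
        · rw [g7 _ hnot, hS₂e, hS₁, Space.setEdge_edge_self]
        · simp [Op.transform, he1]
      · exact g6 q hq
    · intro u hu
      rw [g7 u, hframe u]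
      · rintro rfl; exact hu subset_rfl
      · intro h
        exact hu ((Finset.insert_subset_insert _ (Finset.subset_insert _ _)).trans h)

theorem Space.xForm_eq {z : Oid n} {w w' : Finset (Oid n)} {y y' : ListOp U} (hz : z ∉ w')
    {l : List (PathNode n U)} (hl : IsPath ot w' y' w y l) {S : Space n U} (hcur : S.cur = w')
    (hedge : ∀ p ∈ l, S.HasEdge d p.src p.oid p.op) (hw : w ∈ S.vertices) :
    ∃ S', S.xForm ot d ⟨y, z, w⟩ = some (S', ⟨y', z, w'⟩) ∧
      S'.cur = insert z w' ∧ S.vertices ⊆ S'.vertices ∧ insert z w' ∈ S'.vertices ∧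
      (∀ p ∈ l, insert z p.src ∈ S'.vertices) ∧
      (∀ p ∈ l, S'.HasEdge d (insert z p.src) p.oid (ot p.op p.arg)) := by
  have he : (S.setEdge d.other w (insert z w) ⟨y, z, w⟩).edge d = S.edge d :=
    Space.setEdge_edge_of_ne d.other_ne _ _ _
  obtain ⟨S', g1, g2, g3, g4, g5, g6, -⟩ := Space.xFormLoop_eq (d := d) hz l hl
    (fuel := S.cur.card) (by rw [hcur]; omega)
    (S := S.setEdge d.other w (insert z w) ⟨y, z, w⟩) hcur
    (by
      intro p hp
      simpa [Space.HasEdge, he] using hedge p hp)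
    (by simp [Space.setEdge])
  refine ⟨S', ?_, g2, fun u hu => g3 (by simp [Space.setEdge, hu]), g4, g5, g6⟩
  rw [Space.xForm, if_pos hw]
  exact g1

end Space

variable {s : Sched n U} {ot : ListOp U → ListOp U → ListOp U}

variable (s ot) in
/-- The state space of client `i` after the first `a` operations of the server and `b` local ones.
Only the local edges from the main axis to the current vertex matter for the operations to come. -/
structure ClientSpace (S : Space n U) (i : Fin n) (a b : ℕ) : Prop where
  cur : S.cur = s.vtx i a b
  vertex (c : ℕ) (h : s.clock a i ≤ c) (h' : c ≤ b) : s.vtx i a c ∈ S.vertices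
  edge (c : ℕ) (h : s.clock a i ≤ c) (h' : c < b) :
    S.HasEdge .loc (s.vtx i a c) (i, c + 1) (s.locForm ot a i c)

/-- The receipt of local operations by the server does not change the vertices of a client. -/
theorem ClientSpace.absorb {S : Space n U} {i : Fin n} {a a' b : ℕ} (h : ClientSpace s ot S i a b)
    (hctx : ∀ c < b, s.ctxIdx i c ≤ a) (ha : a ≤ a')
    (hown : ∀ t, a ≤ t → t < a' → s.author t = i) : ClientSpace s ot S i a' b := by
  induction a', ha using Nat.le_induction with
  | base => exact h
  | succ a' ha ih =>
    have ih := ih fun t h1 h2 => hown t h1 (by omega)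
    have hi := hown a' ha (by omega)
    constructor
    · rw [s.vtx_succ_self b hi, ih.cur]
    · intro c hc
      rw [s.vtx_succ_self c hi]
      exact ih.vertex c ((s.clock_mono (Nat.le_succ _) _).trans hc)
    · intro c hc hcb
      rw [s.vtx_succ_self c hi, s.locForm_succ_self ((hctx c hcb).trans ha) hi]
      exact ih.edge c ((s.clock_mono (Nat.le_succ _) _).trans hc) hcb

theorem ClientSpace.append {S : Space n U} {i : Fin n} {a b : ℕ} (h : ClientSpace s ot S i a b)
    (hctx : a = s.ctxIdx i b) {op : Op n U} (ho : op.o = s.orig i b) (hx : op.oid = (i, b + 1)) :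
    ClientSpace s ot (S.append .loc op) i a (b + 1) := by
  have hv : insert op.oid S.cur = s.vtx i a (b + 1) := by rw [hx, h.cur, s.insert_vtx]
  constructor
  · exact hv
  · intro c hc hcb
    rcases Nat.le_succ_iff.1 hcb with hcb | rfl
    · have := h.vertex c hc hcb
      simp [Space.append, Space.setEdge, this]
    · simp [Space.append, Space.setEdge, hv]
  · intro c hc hcb
    rcases Nat.lt_succ_iff_lt_or_eq.1 hcb with hcb | rfl
    · obtain ⟨e, he, he'⟩ := h.edge c hc hcb
      refine ⟨e, ?_, he'⟩
      rw [← he, Space.append_edge]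
      refine Space.setEdge_edge_of_ne_src ?_ _ _
      rw [h.cur]
      intro heq
      have := congrFun (clockSet_injective heq) i
      simp at this
      omega
    · refine ⟨⟨op, insert op.oid S.cur⟩, ?_, ?_, hx, ?_⟩
      · rw [← h.cur, Space.append_edge]
        exact Space.setEdge_edge_self _ _ _
      · rw [s.locForm_ctxIdx hctx, ho]
      · rw [← hx, ← h.cur]

theorem ClientSpace.receive {S : Space n U} {i : Fin n} {a b : ℕ} (h : ClientSpace s ot S i a b)
    (hi : s.author a ≠ i) (hab : s.clock a i ≤ b) (hctx : ∀ c < b, s.ctxIdx i c ≤ a) :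
    ∃ S', S.xForm ot .loc ⟨s.serverForm ot a, s.oid a, clockSet (s.clock a)⟩ =
        some (S', ⟨s.globForm ot a i b, s.oid a, s.vtx i a b⟩) ∧
      ClientSpace s ot S' i (a + 1) b := by
  have hpath := isPath_of_range (ot := ot) (fun _ => True) (s.vtx i a) (fun c => (i, c + 1))
    (s.locForm ot a i) (s.globForm ot a i) hab (fun t _ _ h => absurd trivial h)
    (fun t ht ht' _ => ⟨by simp [Sched.vtx, mem_clockSet], (s.insert_vtx i a t).symm,
      s.globForm_succ ht⟩)
  obtain ⟨S', h1, h2, -, h3, h4, h5⟩ := Space.xForm_eq (d := .loc) (z := s.oid a)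
    (s.oid_notMem_vtx b hi) hpath h.cur
    (by
      intro p hp
      obtain ⟨t, ht, ht', -, rfl⟩ := mem_path_of_range.1 hp
      exact h.edge t ht ht')
    (h.vertex _ le_rfl hab)
  rw [s.globForm_clock, s.vtx_clock] at h1
  refine ⟨S', h1, ?_, ?_, ?_⟩
  · rw [h2, s.insert_oid_vtx b hi]
  · intro c hc hcb
    rw [s.clock_succ_of_ne hi] at hc
    rw [← s.insert_oid_vtx c hi]
    rcases hcb.lt_or_eq with hcb | rfl
    · exact h4 _ (mem_path_of_range.2 ⟨c, hc, hcb, trivial, rfl⟩)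
    · exact h3
  · intro c hc hcb
    rw [s.clock_succ_of_ne hi] at hc
    rw [← s.insert_oid_vtx c hi, s.locForm_succ_of_ne (hctx c hcb) hi]
    exact h5 _ (mem_path_of_range.2 ⟨c, hc, hcb, trivial, rfl⟩)

variable (s ot) in
/-- The state space of the server for client `i` after `a` operations.  Only the vertices with all
received operations of `i` matter for the operations to come. -/
structure ServerSpace (S : Space n U) (i : Fin n) (a : ℕ) : Prop where
  cur : S.cur = clockSet (s.clock a)
  vertex (t : ℕ) (h : t ≤ a) (hctx : ∀ c < s.clock a i, s.ctxIdx i c ≤ t) :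
    s.vtx i t (s.clock a i) ∈ S.vertices
  edge (t : ℕ) (h : t < a) (hi : s.author t ≠ i) (hctx : ∀ c < s.clock a i, s.ctxIdx i c ≤ t) :
    S.HasEdge .glob (s.vtx i t (s.clock a i)) (s.oid t) (s.globForm ot t i (s.clock a i))

theorem ServerSpace.append {S : Space n U} {i : Fin n} {a : ℕ} (h : ServerSpace s ot S i a)
    (hi : s.author a ≠ i) {op : Op n U} (ho : op.o = s.serverForm ot a) (hx : op.oid = s.oid a) :
    ServerSpace s ot (S.append .glob op) i (a + 1) := by
  have hv : insert op.oid S.cur = clockSet (s.clock (a + 1)) := by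
    rw [hx, h.cur, s.insert_oid_clockSet]
  have hc := s.clock_succ_of_ne hi
  constructor
  · exact hv
  · intro t ht hctx
    rw [hc] at hctx ⊢
    rcases Nat.le_succ_iff.1 ht with ht | rfl
    · have := h.vertex t ht hctx
      simp [Space.append, Space.setEdge, this]
    · rw [← hc, s.vtx_clock]
      simp [Space.append, Space.setEdge, hv]
  · intro t ht hti hctx
    rw [hc] at hctx ⊢
    rcases Nat.lt_succ_iff_lt_or_eq.1 ht with ht | rfl
    · obtain ⟨e, he, he'⟩ := h.edge t ht hti hctx
      refine ⟨e, ?_, he'⟩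
      rw [← he, Space.append_edge]
      refine Space.setEdge_edge_of_ne_src ?_ _ _
      rw [h.cur]
      intro heq
      exact s.oid_notMem_vtx _ hti (heq ▸ s.oid_mem_clockSet ht)
    · rw [s.vtx_clock, s.globForm_clock, ← h.cur]
      refine ⟨⟨op, insert op.oid S.cur⟩, ?_, ho, hx, by rw [hx]⟩
      rw [Space.append_edge]
      exact Space.setEdge_edge_self _ _ _

theorem ServerSpace.receive {S : Space n U} {i : Fin n} {a : ℕ} (h : ServerSpace s ot S i a)
    (hi : s.author a = i) (hle : s.ctxIdx i (s.clock a i) ≤ a)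
    (hmono : ∀ c < s.clock a i, s.ctxIdx i c ≤ s.ctxIdx i (s.clock a i)) :
    ∃ S', S.xForm ot .glob ⟨s.orig i (s.clock a i), s.oid a,
          s.vtx i (s.ctxIdx i (s.clock a i)) (s.clock a i)⟩ =
        some (S', ⟨s.serverForm ot a, s.oid a, clockSet (s.clock a)⟩) ∧
      ServerSpace s ot S' i (a + 1) := by
  have hz : s.oid a = (i, s.clock a i + 1) := by simp [Sched.oid, hi]
  have hle' : ∀ t < a, s.clock t i ≤ s.clock a i := fun t ht => s.clock_mono ht.le i
  set k := s.clock a i with hk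
  have hskip : ∀ t, s.author t = i → s.vtx i (t + 1) k = s.vtx i t k :=
    fun t ht => s.vtx_succ_self k ht
  have hpath := isPath_of_range (ot := ot) (fun t => s.author t ≠ i) (fun t => s.vtx i t k) s.oid
    (fun t => s.globForm ot t i k) (fun t => s.locForm ot t i k) hle
    (fun t ht _ h => ⟨hskip t (not_not.1 h), s.locForm_succ_self ht (not_not.1 h)⟩)
    (fun t ht ht' hE => ⟨s.oid_notMem_vtx k hE, (s.insert_oid_vtx k hE).symm,
      s.locForm_succ_of_ne ht hE⟩)
  have hvk : s.vtx i a k = clockSet (s.clock a) := s.vtx_clock i a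
  obtain ⟨S', h1, h2, -, h3, h4, h5⟩ := Space.xForm_eq (d := .glob) (z := s.oid a)
    (by rw [hvk]; exact s.oid_notMem_clockSet le_rfl) hpath (hvk ▸ h.cur)
    (by
      intro p hp
      obtain ⟨t, ht, ht', hE, rfl⟩ := mem_path_of_range.1 hp
      exact h.edge t ht' hE fun c hc => (hmono c hc).trans ht)
    (h.vertex _ hle hmono)
  have hF : s.locForm ot a i k = s.serverForm ot a := by rw [Sched.serverForm, hi]
  have hins : ∀ t, insert (s.oid a) (s.vtx i t k) = s.vtx i t (k + 1) := by
    intro t; rw [hz, s.insert_vtx]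
  have hc : s.clock (a + 1) i = k + 1 := s.clock_succ_self hi
  rw [s.locForm_ctxIdx rfl, hF, hvk] at h1
  refine ⟨S', h1, ?_, ?_, ?_⟩
  · rw [h2, hvk, s.insert_oid_clockSet]
  · rw [hc]
    intro t ht hctx
    have hpt := hctx k (Nat.lt_succ_self _)
    rcases Nat.le_succ_iff.1 ht with ht | rfl
    · rw [← hins]
      rcases eq_or_exists_edge (E := fun t => s.author t ≠ i) (w := fun t => s.vtx i t k) ht
        (fun t' _ _ h => hskip t' (not_not.1 h)) with he | ⟨t', h6, h7, h8, h9⟩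
      · rwa [he]
      · rw [h9]
        exact h4 _ (mem_path_of_range.2 ⟨t', hpt.trans h6, h7, h8, rfl⟩)
    · rw [s.vtx_succ_self _ hi, ← hins]
      exact h3
  · rw [hc]
    intro t ht hti hctx
    have hpt := hctx k (Nat.lt_succ_self _)
    rcases Nat.lt_succ_iff_lt_or_eq.1 ht with ht | rfl
    · rw [← hins, s.globForm_succ (hle' t ht)]
      exact h5 _ (mem_path_of_range.2 ⟨t, hpt, ht, hti, rfl⟩)
    · exact absurd hi hti

variable (s ot) in
/-- Jupiter: the server sends its operations in the form in which it executes them. -/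
noncomputable def realization : s.Realization ot (protocol n ot) where
  upMsg i b := (⟨s.orig i b, (i, b + 1), s.vtx i (s.ctxIdx i b) b⟩ : Op n U)
  downMsg a := (⟨s.serverForm ot a, s.oid a, clockSet (s.clock a)⟩ : Op n U)
  Client i a b C := C.cid = i ∧ C.seq = b ∧ ClientSpace s ot C.S i a b
  Server a S := ∀ i, ServerSpace s ot (S.SS i) i a
  client₀ i := by
    refine ⟨⟨rfl, rfl, ?_, ?_, ?_⟩, rfl⟩
    · simp [protocol, Space.empty, Sched.vtx, s.clock_zero, clockSet_zero]
    · rintro c - hc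
      obtain rfl : c = 0 := Nat.le_zero.1 hc
      simp [protocol, Space.empty, Sched.vtx, s.clock_zero, clockSet_zero]
    · intro c _ hc
      exact absurd hc (Nat.not_lt_zero _)
  server₀ := by
    refine ⟨fun i => ⟨?_, ?_, ?_⟩, rfl⟩
    · simp [protocol, Space.empty, s.clock_zero, clockSet_zero]
    · rintro t ht -
      obtain rfl : t = 0 := Nat.le_zero.1 ht
      simp [protocol, Space.empty, Sched.vtx, s.clock_zero, clockSet_zero]
    · intro t ht
      exact absurd ht (Nat.not_lt_zero _)
  msgOid_up _ _ := rfl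
  msgOid_down _ := rfl
  clientDo := by
    rintro i a b C ⟨rfl, rfl, h⟩ ha
    refine ⟨_, Prod.ext rfl ?_, ⟨rfl, rfl, h.append ha rfl rfl⟩, rfl⟩
    rw [← ha, ← h.cur]
    rfl
  clientReceive := by
    rintro i a a' b C ⟨h1, h2, h⟩ ha hown hi hb hctx -
    obtain ⟨S', hx, hS'⟩ := (h.absorb hctx ha hown).receive hi hb fun c hc => (hctx c hc).trans ha
    refine ⟨⟨C.cid, C.seq, C.state ++ [s.globForm ot a' i b], S'⟩, ?_, ⟨h1, h2, hS'⟩, rfl⟩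
    simp only [protocol, Client.receive, hx, Option.map_some]
  serverReceive := by
    rintro a S h hcausal
    obtain ⟨S', hx, hS'⟩ := (h (s.author a)).receive rfl hcausal.1 hcausal.2
    refine ⟨⟨S.state ++ [s.serverForm ot a], fun j => if j = s.author a then S' else
      (S.SS j).append .glob ⟨s.serverForm ot a, s.oid a, clockSet (s.clock a)⟩⟩, ?_, ?_, rfl⟩
    · rw [Sched.oid] at hx
      simp only [protocol, Server.receive, hx, Option.map_some]
      rfl
    · intro j
      dsimp only
      by_cases hj : j = s.author a
      · subst hj; rw [if_pos rfl]; exact hS'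
      · rw [if_neg hj]
        exact (h j).append (Ne.symm hj) rfl rfl

end Jupiter

/-! ### CJupiter -/

namespace CJupiter

/-- The first edge from `u` has a label with the identifier `x`, the form `o`, and a server context
that is contained in `A`. -/
def Space.HasFirst (S : Space n U) (A u : Finset (Oid n)) (x : Oid n) (o : ListOp U) : Prop :=
  ∃ e, (S.edges u).head? = some e ∧ e.op.o = o ∧ e.op.oid = x ∧ e.tgt = insert x u ∧ e.op.sctx ⊆ A

section Space

variable {ot : ListOp U → ListOp U → ListOp U} {S : Space n U} {r : Replica n}
  {A u : Finset (Oid n)} {x : Oid n} {o : ListOp U}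

theorem Space.HasFirst.mono {A' : Finset (Oid n)} (h : S.HasFirst A u x o) (hA : A ⊆ A') :
    S.HasFirst A' u x o := by
  obtain ⟨e, h1, h2, h3, h4, h5⟩ := h
  exact ⟨e, h1, h2, h3, h4, h5.trans hA⟩

theorem Space.HasFirst.edges_ne_nil (h : S.HasFirst A u x o) : S.edges u ≠ [] := by
  obtain ⟨e, h1, -⟩ := h
  intro h0
  simp [h0] at h1

theorem Space.HasFirst.of_head_eq {S' : Space n U} (h : S.HasFirst A u x o)
    (he : (S'.edges u).head? = (S.edges u).head?) : S'.HasFirst A u x o := by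
  obtain ⟨e, h1, h2⟩ := h
  exact ⟨e, he.trans h1, h2⟩

theorem Space.link_edges_of_ne {w : Finset (Oid n)} (h : u ≠ w) (v : Finset (Oid n)) (op : Op n U) :
    (S.link r w v op).edges u = S.edges u := by
  simp [Space.link, Function.update_of_ne h]

theorem Space.link_edges_of_nil {w : Finset (Oid n)} (h : S.edges w = []) (v : Finset (Oid n))
    (op : Op n U) : (S.link r w v op).edges w = [⟨op, v⟩] := by
  simp [Space.link, h, insertEdge]

theorem Space.link_head_of_not_before {w : Finset (Oid n)} {e : Edge n U} {op : Op n U}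
    (h : (S.edges w).head? = some e) (hb : op.before r e.op = false) (v : Finset (Oid n)) :
    ((S.link r w v op).edges w).head? = some e := by
  cases hl : S.edges w with
  | nil => simp [hl] at h
  | cons e' es =>
    obtain rfl : e' = e := by simpa [hl] using h
    simp [Space.link, hl, insertEdge, hb]

theorem Space.link_head_of_before {w : Finset (Oid n)} {e : Edge n U} {op : Op n U}
    (h : (S.edges w).head? = some e) (hb : op.before r e.op = true) (v : Finset (Oid n)) :
    ((S.link r w v op).edges w).head? = some ⟨op, v⟩ := by
  cases hl : S.edges w with
  | nil => simp [hl] at h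
  | cons e' es =>
    obtain rfl : e' = e := by simpa [hl] using h
    simp [Space.link, hl, insertEdge, hb]

/-- The loop of `xForm` runs along a path of first edges and copies it, with the labels transformed.
The new edges at the vertices of the path come first there exactly where the former first edge
belongs to an operation outside of the server context `A` of the transformed operation. -/
theorem Space.xFormLoop_eq {z : Oid n} {w' : Finset (Oid n)} {y' : ListOp U} (hz : z ∉ w')
    (hzA : z ∉ A) (l : List (PathNode n U)) {w : Finset (Oid n)} {y : ListOp U}
    (hl : IsPath ot w' y' w y l) {fuel : ℕ} (hfuel : w'.card ≤ fuel + w.card) {S : Space n U}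
    (hcur : S.cur = w') (hfirst : ∀ p ∈ l, S.HasFirst A p.src p.oid p.op)
    (horder : ∀ p ∈ l, p.oid ∈ A ∨ Replica.client z.1 ≠ r)
    (hfresh : ∀ u, insert z w ⊆ u → S.edges u = []) (hend : S.edges w' = [])
    (hv : insert z w ∈ S.vertices) :
    ∃ S', Space.xFormLoop ot r fuel S w (insert z w) ⟨y, z, w, A⟩ = some (S', ⟨y', z, w', A⟩) ∧
      S'.cur = insert z w' ∧ S.vertices ⊆ S'.vertices ∧ insert z w' ∈ S'.vertices ∧
      (∀ p ∈ l, insert z p.src ∈ S'.vertices) ∧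
      (∀ u, ¬ w ⊆ u → S'.edges u = S.edges u) ∧
      (∀ u x o, z ∉ u → x ∈ A → S.HasFirst A u x o → S'.HasFirst A u x o) ∧
      (∀ p ∈ l, p.oid ∉ A → S'.HasFirst A p.src z p.arg) ∧
      S'.HasFirst A w' z y' ∧
      (∀ p ∈ l, S'.HasFirst A (insert z p.src) p.oid (ot p.op p.arg)) ∧
      ∀ u, S'.edges u ≠ [] → S.edges u ≠ [] ∨ u ⊂ insert z w' := by
  induction l generalizing w y fuel S with
  | nil =>
    obtain ⟨rfl, rfl⟩ := hl
    refine ⟨{ S.link r w (insert z w) ⟨y, z, w, A⟩ with cur := insert z w }, ?_, rfl, subset_rfl,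
      hv, by simp, ?_, ?_, by simp, ?_, by simp, ?_⟩
    · rw [Space.xFormLoop.eq_def]
      exact if_pos hcur.symm
    · intro u hu
      exact Space.link_edges_of_ne (by rintro rfl; exact hu subset_rfl) _ _
    · intro u x o _ _ h
      refine h.of_head_eq (congrArg _ (Space.link_edges_of_ne ?_ _ _))
      rintro rfl
      exact h.edges_ne_nil hend
    · exact ⟨⟨⟨y, z, w, A⟩, insert z w⟩,
        congrArg List.head? (Space.link_edges_of_nil hend _ _), rfl, rfl, rfl, subset_rfl⟩
    · intro u hu
      by_cases h : u = w
      · subst h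
        exact .inr (Finset.ssubset_insert hz)
      · exact .inl fun h0 => hu ((Space.link_edges_of_ne h _ _).trans h0)
  | cons p l ih =>
    obtain ⟨h1, h2, h3, h4⟩ := hl
    subst h1 h2
    have hsub := h4.subset
    have hpw' : p.oid ∈ w' := hsub (Finset.mem_insert_self _ _)
    have hne : p.src ≠ S.cur := by
      rintro h
      exact h3 (by rwa [h, hcur])
    have hcard := Finset.card_insert_of_notMem h3
    have hcard' := Finset.card_le_card hsub
    obtain ⟨fuel, rfl⟩ : ∃ f, fuel = f + 1 := ⟨fuel - 1, by omega⟩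
    have hfp := hfirst p List.mem_cons_self
    obtain ⟨e, he, he1, he2, he3, he4⟩ := hfirst p List.mem_cons_self
    have hzw : z ∉ insert p.oid p.src := fun h => hz (hsub h)
    have hzs : z ∉ p.src := fun h => hzw (Finset.mem_insert_of_mem h)
    have hpz : p.oid ≠ z := by rintro rfl; exact hzw (Finset.mem_insert_self _ _)
    have hcomm : insert p.oid (insert z p.src) = insert z (insert p.oid p.src) :=
      Finset.insert_comm _ _ _
    have hpv : p.oid ∉ insert z p.src := by simp [h3, hpz]
    have hvw : insert z p.src ≠ p.src := fun h => hzs (h ▸ Finset.mem_insert_self _ _)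
    have hvnil : S.edges (insert z p.src) = [] := hfresh _ subset_rfl
    set S₁ := S.addVertex (insert z (insert p.oid p.src)) with hS₁
    set S₂ := S₁.link r (insert z p.src) (insert z (insert p.oid p.src))
      (e.op.transform ot ⟨p.arg, z, p.src, A⟩) with hS₂
    set S₃ := S₂.link r p.src (insert z p.src) ⟨p.arg, z, p.src, A⟩ with hS₃
    have hframe : ∀ u, u ≠ insert z p.src → u ≠ p.src → S₃.edges u = S.edges u := by
      intro u hu hu'
      rw [hS₃, Space.link_edges_of_ne hu', hS₂, Space.link_edges_of_ne hu]
      rfl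
    have hheadv : S₃.edges (insert z p.src) =
        [⟨e.op.transform ot ⟨p.arg, z, p.src, A⟩, insert z (insert p.oid p.src)⟩] := by
      rw [hS₃, Space.link_edges_of_ne hvw, hS₂, Space.link_edges_of_nil]
      exact hvnil
    have he' : (S₂.edges p.src).head? = some e := by
      rw [hS₂, Space.link_edges_of_ne hvw.symm]
      exact he
    have hze : z ∉ e.op.sctx := fun h => hzA (he4 h)
    have hkeep : ∀ u x o, z ∉ u → x ∈ A → S.HasFirst A u x o → S₃.HasFirst A u x o := by
      intro u x o hzu hxA h
      by_cases hu : u = p.src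
      · subst hu
        refine h.of_head_eq ?_
        obtain ⟨e', h5, -, h6, -⟩ := h
        obtain rfl : e' = e := Option.some.inj (h5.symm.trans he)
        rw [he, hS₃, Space.link_head_of_not_before he']
        simp [Op.before, hze, h6, hxA]
      · exact h.of_head_eq
          (by rw [hframe u (by rintro rfl; exact hzu (Finset.mem_insert_self _ _)) hu])
    have hfst : ∀ q ∈ l, S₃.HasFirst A q.src q.oid q.op := by
      intro q hq
      obtain ⟨h5, h6, h7⟩ := h4.src_subset hq
      refine (hfirst q (List.mem_cons_of_mem _ hq)).of_head_eq ?_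
      rw [hframe]
      · rintro h
        exact hz (h5 (Finset.mem_insert_of_mem (h ▸ Finset.mem_insert_self _ _)))
      · rintro h
        exact h3 (h ▸ h6 (Finset.mem_insert_self _ _))
    have hw'v : w' ≠ insert z p.src := fun h => hz (h ▸ Finset.mem_insert_self _ _)
    have hw'w : w' ≠ p.src := fun h => h3 (h ▸ hpw')
    obtain ⟨S', g1, g2, g3, g4, g5, g6, g7, g8, g9, g10, g11⟩ := ih (S := S₃) (fuel := fuel) h4
      (by omega) hcur hfst (fun q hq => horder q (List.mem_cons_of_mem _ hq))
      (by
        intro u hu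
        rw [hframe u]
        · exact hfresh u ((Finset.insert_subset_insert _ (Finset.subset_insert _ _)).trans hu)
        · rintro rfl
          exact hpv (hu (by simp))
        · rintro rfl
          exact hzs (hu (by simp)))
      (by rw [hframe _ hw'v hw'w, hend])
      (by simp [hS₃, hS₂, hS₁, Space.link, Space.addVertex])
    have hvv : S.vertices ⊆ S₃.vertices := by
      intro u hu
      simp [hS₃, hS₂, hS₁, Space.link, Space.addVertex, hu]
    have hnot : ¬ insert p.oid p.src ⊆ insert z p.src := fun h => hpv (h (by simp))
    have hnot' : ¬ insert p.oid p.src ⊆ p.src := fun h => h3 (h (by simp))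
    refine ⟨S', ?_, g2, hvv.trans g3, g4, ?_, ?_, ?_, ?_, g9, ?_, ?_⟩
    · rw [Space.xFormLoop.eq_def]
      dsimp only
      rw [if_neg hne]
      simp only [he, he2, he3, hcomm]
      rw [← g1]
      simp only [Op.transform, he1, he2, hS₃, hS₂, hS₁]
    · intro q hq
      rcases List.mem_cons.1 hq with rfl | hq
      · exact g3 (hvv hv)
      · exact g5 q hq
    · intro u hu
      rw [g6 u fun h => hu ((Finset.subset_insert _ _).trans h), hframe u]
      · rintro rfl; exact hu (Finset.subset_insert _ _)
      · rintro rfl; exact hu subset_rfl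
    · intro u x o hzu hxA h
      exact g7 u x o hzu hxA (hkeep u x o hzu hxA h)
    · intro q hq hqA
      rcases List.mem_cons.1 hq with rfl | hq
      · refine ⟨⟨⟨q.arg, z, q.src, A⟩, insert z q.src⟩, ?_, rfl, rfl, rfl, subset_rfl⟩
        rw [g6 _ hnot', hS₃, Space.link_head_of_before he']
        have hr := (horder q List.mem_cons_self).resolve_left hqA
        simp [Op.before, hze, he2, hqA, hr]
      · exact g8 q hq hqA
    · intro q hq
      rcases List.mem_cons.1 hq with rfl | hq
      · refine ⟨⟨e.op.transform ot ⟨q.arg, z, q.src, A⟩, insert z (insert q.oid q.src)⟩, ?_, ?_,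
          he2, hcomm.symm, he4⟩
        · rw [g6 _ hnot, hheadv]; rfl
        · simp [Op.transform, he1]
      · exact g10 q hq
    · intro u hu
      rcases g11 u hu with h | h
      · by_cases hu1 : u = insert z p.src
        · subst hu1
          refine .inr ⟨Finset.insert_subset_insert _ ((Finset.subset_insert _ _).trans hsub), ?_⟩
          intro h'
          exact hpv (h' (Finset.mem_insert_of_mem hpw'))
        · by_cases hu2 : u = p.src
          · subst hu2; exact .inl hfp.edges_ne_nil
          · rw [hframe u hu1 hu2] at h; exact .inl h
      · exact .inr h

end Space

variable {s : Sched n U} {ot : ListOp U → ListOp U → ListOp U}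

variable (s ot) in
/-- The state space of a replica that knows the operations given by the vector clock `q`, among them
the first `a` operations of the server.  The first edge from a vertex belongs to the first of the
missing operations, if the operations of the server are ordered before the pending ones. -/
structure StateSpace (S : Space n U) (a : ℕ) (q : Fin n → ℕ) : Prop where
  cur : S.cur = clockSet q
  vertex (j : Fin n) (t b : ℕ) (ht : t ≤ a) (hb : s.clock t j ≤ b) (hq : b ≤ q j)
    (hctx : ∀ c < b, s.ctxIdx j c ≤ t) : s.vtx j t b ∈ S.vertices
  first (j : Fin n) (t b : ℕ) (ht : t < a) (hj : s.author t ≠ j) (hb : s.clock t j ≤ b)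
    (hq : b ≤ q j) (hctx : ∀ c < b, s.ctxIdx j c ≤ t) :
    S.HasFirst (clockSet (s.clock a)) (s.vtx j t b) (s.oid t) (s.globForm ot t j b)
  pending (j : Fin n) (b : ℕ) (hb : s.clock a j ≤ b) (hq : b < q j) :
    S.HasFirst (clockSet (s.clock a)) (s.vtx j a b) (j, b + 1) (s.locForm ot a j b)
  edges (u : Finset (Oid n)) (h : S.edges u ≠ []) : u ⊂ clockSet q

theorem stateSpace_empty : StateSpace s ot Space.empty 0 (fun _ => 0) := by
  refine ⟨?_, ?_, ?_, ?_, ?_⟩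
  · simp [Space.empty, clockSet_zero]
  · intro j t b ht hb hq _
    obtain rfl : t = 0 := Nat.le_zero.1 ht
    obtain rfl : b = 0 := Nat.le_zero.1 hq
    simp [Space.empty, Sched.vtx, s.clock_zero, clockSet_zero]
  · intro j t b ht
    exact absurd ht (Nat.not_lt_zero _)
  · intro j b _ hq
    exact absurd hq (Nat.not_lt_zero _)
  · intro u h
    exact absurd rfl h

/-- When the server receives a pending operation of client `i`, the state space of `i` does not
change: the operation only ceases to be pending. -/
theorem StateSpace.absorb_one {S : Space n U} {a : ℕ} {i : Fin n} {b : ℕ}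
    (h : StateSpace s ot S a (Function.update (s.clock a) i b)) (hi : s.author a = i)
    (hb : s.clock a i < b) (hctx : ∀ c < b, s.ctxIdx i c ≤ a) :
    StateSpace s ot S (a + 1) (Function.update (s.clock (a + 1)) i b) := by
  have hq : Function.update (s.clock (a + 1)) i b = Function.update (s.clock a) i b := by
    rw [s.clock_succ, hi, Function.update_idem]
  have hA : clockSet (s.clock a) ⊆ clockSet (s.clock (a + 1)) :=
    clockSet_subset.2 (s.clock_mono (Nat.le_succ a))
  have hother : ∀ j ≠ i, ∀ c, s.clock a j ≤ c → c ≤ Function.update (s.clock a) i b j →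
      c = s.clock a j := by
    intro j hj c h1 h2
    rw [Function.update_of_ne hj] at h2
    omega
  rw [hq]
  refine ⟨h.cur, ?_, ?_, ?_, h.edges⟩
  · intro j t c ht hc hcq hctx'
    rcases Nat.le_succ_iff.1 ht with ht | rfl
    · exact h.vertex j t c ht hc hcq hctx'
    · by_cases hj : j = i
      · subst hj
        rw [s.vtx_succ_self c hi]
        rw [Function.update_self] at hcq
        exact h.vertex j a c le_rfl ((s.clock_mono (Nat.le_succ a) j).trans hc)
          (by rwa [Function.update_self]) fun c' hc' => hctx c' (by omega)
      · have hji : s.author a ≠ j := by rw [hi]; exact Ne.symm hj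
        rw [s.clock_succ_of_ne hji] at hc
        obtain rfl := hother j hj c hc hcq
        rw [← s.clock_succ_of_ne hji, s.vtx_clock, ← s.vtx_clock i, s.vtx_succ_self _ hi,
          s.clock_succ_self hi]
        exact h.vertex i a _ le_rfl (Nat.le_succ _) (by rwa [Function.update_self])
          fun c' hc' => hctx c' (by omega)
  · intro j t c ht hj hc hcq hctx'
    rcases Nat.lt_succ_iff_lt_or_eq.1 ht with ht | rfl
    · exact (h.first j t c ht hj hc hcq hctx').mono hA
    · obtain rfl := hother j (by rintro rfl; exact hj hi) c hc hcq
      have := h.pending i (s.clock t i) le_rfl (by rwa [Function.update_self])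
      rw [s.vtx_clock] at this ⊢
      rw [s.globForm_clock, Sched.serverForm, Sched.oid, hi]
      exact this.mono hA
  · intro j c hc hcq
    by_cases hj : j = i
    · subst hj
      rw [Function.update_self] at hcq
      rw [s.vtx_succ_self c hi, s.locForm_succ_self (hctx c hcq) hi]
      exact (h.pending j c ((s.clock_mono (Nat.le_succ a) j).trans hc)
        (by rwa [Function.update_self])).mono hA
    · rw [Function.update_of_ne hj] at hcq
      exact absurd (hc.trans_lt hcq) (not_lt.2 (s.clock_mono (Nat.le_succ a) j))

theorem StateSpace.absorb {S : Space n U} {a a' : ℕ} {i : Fin n} {b : ℕ}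
    (h : StateSpace s ot S a (Function.update (s.clock a) i b)) (ha : a ≤ a')
    (hown : ∀ t, a ≤ t → t < a' → s.author t = i) (hb : s.clock a' i ≤ b)
    (hctx : ∀ c < b, s.ctxIdx i c ≤ a) :
    StateSpace s ot S a' (Function.update (s.clock a') i b) := by
  induction a', ha using Nat.le_induction with
  | base => exact h
  | succ a' ha ih =>
    have hi := hown a' ha (Nat.lt_succ_self _)
    rw [s.clock_succ_self hi] at hb
    exact (ih (fun t h1 h2 => hown t h1 (by omega)) (by omega)).absorb_one hi (by omega)
      fun c hc => (hctx c hc).trans ha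

theorem StateSpace.doOp {S : Space n U} {a : ℕ} {i : Fin n} {b : ℕ}
    (h : StateSpace s ot S a (Function.update (s.clock a) i b)) (hctx : a = s.ctxIdx i b)
    {r : Replica n} {op : Op n U} (ho : op.o = s.orig i b) (hx : op.oid = (i, b + 1))
    (hs : op.sctx = ∅) :
    StateSpace s ot
      { (S.addVertex (insert op.oid S.cur)).link r S.cur (insert op.oid S.cur) op with
        cur := insert op.oid S.cur }
      a (Function.update (s.clock a) i (b + 1)) := by
  have hv : insert op.oid S.cur = s.vtx i a (b + 1) := by
    rw [hx, h.cur]; exact s.insert_vtx i a b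
  have hnil : S.edges S.cur = [] := by
    by_contra h0
    have := h.edges _ h0
    rw [h.cur] at this
    exact ssubset_irrefl _ this
  have hcases : ∀ j c, c ≤ Function.update (s.clock a) i (b + 1) j →
      c ≤ Function.update (s.clock a) i b j ∨ j = i ∧ c = b + 1 := by
    intro j c hc
    by_cases hj : j = i
    · subst hj
      rw [Function.update_self] at hc ⊢
      omega
    · rw [Function.update_of_ne hj] at hc ⊢
      exact .inl hc
  set S' : Space n U := { (S.addVertex (insert op.oid S.cur)).link r S.cur (insert op.oid S.cur) op
    with cur := insert op.oid S.cur } with hS'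
  have hframe : ∀ u, u ≠ S.cur → S'.edges u = S.edges u :=
    fun u hu => Space.link_edges_of_ne (S := S.addVertex _) hu _ _
  have hkeep : ∀ {A u x o}, S.HasFirst A u x o → S'.HasFirst A u x o := by
    intro A u x o hf
    refine hf.of_head_eq ?_
    rw [hframe]
    rintro rfl
    exact hf.edges_ne_nil hnil
  refine ⟨hv, ?_, ?_, ?_, ?_⟩
  · intro j t c ht hc hcq hctx'
    rcases hcases j c hcq with hcq | ⟨rfl, rfl⟩
    · have := h.vertex j t c ht hc hcq hctx'
      simp [hS', Space.link, Space.addVertex, this]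
    · obtain rfl : t = a := le_antisymm ht (hctx ▸ hctx' b (Nat.lt_succ_self b))
      simp [hS', Space.link, Space.addVertex, hv]
  · intro j t c ht hj hc hcq hctx'
    rcases hcases j c hcq with hcq | ⟨rfl, rfl⟩
    · exact hkeep (h.first j t c ht hj hc hcq hctx')
    · have := hctx' b (Nat.lt_succ_self b)
      omega
  · intro j c hc hcq
    rcases hcases j (c + 1) hcq with hcq | ⟨rfl, hcb⟩
    · exact hkeep (h.pending j c hc hcq)
    · obtain rfl : c = b := by omega
      refine ⟨⟨op, insert op.oid S.cur⟩, ?_, ?_, hx, ?_, by simp [hs]⟩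
      · have := Space.link_edges_of_nil (S := S.addVertex (insert op.oid S.cur)) (r := r) hnil
          (insert op.oid S.cur) op
        rw [show s.vtx j a c = S.cur from h.cur.symm]
        exact congrArg List.head? this
      · rw [s.locForm_ctxIdx hctx, ho]
      · rw [hx, h.cur]; rfl
  · intro u hu
    have hlt : S.cur ⊂ insert op.oid S.cur := by
      apply Finset.ssubset_insert
      rw [hx, h.cur]
      simp [mem_clockSet]
    change u ⊂ s.vtx i a (b + 1)
    rw [← hv]
    by_cases huc : u = S.cur
    · rwa [huc]
    · rw [hframe u huc] at hu
      have := h.edges u hu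
      rw [← h.cur] at this
      exact this.trans hlt

/-- A replica transforms the operation number `a` of the server: along the missing operations of the
server, and then along its own pending operations, number `s.clock a i` to `b - 1`. -/
theorem StateSpace.receive {S : Space n U} {a : ℕ} {i : Fin n} {b : ℕ} {r : Replica n}
    (h : StateSpace s ot S a (Function.update (s.clock a) i b)) (hb : s.clock a i ≤ b)
    (hr : s.clock a i < b → s.author a ≠ i ∧ r = .client i)
    (hctx : ∀ c < b, s.clock a i ≤ c → s.ctxIdx i c ≤ a) (hcausal : s.Causal a) :
    ∃ S' op, S.xForm ot r ⟨s.orig (s.author a) (s.clock a (s.author a)), s.oid a,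
          s.vtx (s.author a) (s.ctxIdx (s.author a) (s.clock a (s.author a)))
            (s.clock a (s.author a)), clockSet (s.clock a)⟩ = some (S', op) ∧
      op.o = s.globForm ot a i b ∧
      StateSpace s ot S' (a + 1) (Function.update (Function.update (s.clock a) i b) (s.author a)
        (s.clock a (s.author a) + 1)) := by
  obtain ⟨hpa, hmono⟩ := hcausal
  have hz : s.oid a = (s.author a, s.clock a (s.author a) + 1) := rfl
  obtain ⟨j, hj⟩ : ∃ j, s.author a = j := ⟨_, rfl⟩
  rw [hj] at hpa hmono hz hr ⊢
  obtain ⟨k, hk⟩ : ∃ k, s.clock a j = k := ⟨_, rfl⟩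
  rw [hk] at hpa hmono hz ⊢
  obtain ⟨p, hp⟩ : ∃ p, s.ctxIdx j k = p := ⟨_, rfl⟩
  rw [hp] at hpa hmono ⊢
  set q := Function.update (s.clock a) i b with hq
  set A := clockSet (s.clock a) with hA
  set z := s.oid a with hzdef
  have hqj : q j = k := by
    by_cases hji : j = i
    · subst hji
      have : ¬ s.clock a j < b := fun hlt => (hr hlt).1 rfl
      rw [hq, Function.update_self]
      omega
    · rw [hq, Function.update_of_ne hji, hk]
  have hqle : ∀ j', s.clock a j' ≤ q j' := by
    intro j'
    by_cases hji : j' = i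
    · subst hji; rwa [hq, Function.update_self]
    · rw [hq, Function.update_of_ne hji]
  have hother : ∀ j' ≠ i, ∀ c, s.clock a j' ≤ c → c ≤ q j' → c = s.clock a j' := by
    intro j' hji c h1 h2
    rw [hq, Function.update_of_ne hji] at h2
    omega
  have hzq : z ∉ clockSet q := by
    rw [hz, ← hqj]
    exact notMem_clockSet q j
  have hzA : z ∉ A := s.oid_notMem_clockSet le_rfl
  have hck : ∀ t, t ≤ a → s.clock t j ≤ k := fun t ht => hk ▸ s.clock_mono ht j
  have hinsj : ∀ t, insert z (s.vtx j t k) = s.vtx j t (k + 1) := by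
    intro t; rw [hz, s.insert_vtx]
  have hinsi : ∀ j' ≠ j, ∀ c, insert z (s.vtx j' a c) = s.vtx j' (a + 1) c := by
    intro j' hj' c
    exact s.insert_oid_vtx c (by rw [hj]; exact hj'.symm)
  have hmain : ∀ j', s.vtx j' a (s.clock a j') = A := fun j' => s.vtx_clock j' a
  have hjk : s.vtx j a k = A := by rw [← hk]; exact hmain j
  have hF : s.locForm ot a j k = s.serverForm ot a := by rw [Sched.serverForm, hj, hk]
  have hskip : ∀ t, s.author t = j → s.vtx j (t + 1) k = s.vtx j t k :=
    fun t ht => s.vtx_succ_self k ht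
  -- The path leads along the missing operations of the server to the vertex `A`, and then along the
  -- pending operations of client `i` to the current vertex.
  have hpath₁ := isPath_of_range (ot := ot) (fun t => s.author t ≠ j) (fun t => s.vtx j t k) s.oid
    (fun t => s.globForm ot t j k) (fun t => s.locForm ot t j k) hpa
    (fun t ht _ h => ⟨hskip t (not_not.1 h), s.locForm_succ_self (hp.le.trans ht) (not_not.1 h)⟩)
    (fun t ht ht' hE => ⟨s.oid_notMem_vtx k hE, (s.insert_oid_vtx k hE).symm,
      s.locForm_succ_of_ne (hp.le.trans ht) hE⟩)
  have hpath₂ := isPath_of_range (ot := ot) (fun _ => True) (s.vtx i a) (fun c => (i, c + 1))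
    (s.locForm ot a i) (s.globForm ot a i) hb (fun t _ _ h => absurd trivial h)
    (fun t ht ht' _ => ⟨by simp [Sched.vtx, mem_clockSet], (s.insert_vtx i a t).symm,
      s.globForm_succ ht⟩)
  rw [s.globForm_clock, hmain] at hpath₂
  rw [s.locForm_ctxIdx hp.symm, hF, hjk] at hpath₁
  set l₁ : List (PathNode n U) := ((List.range' p (a - p)).filter (fun t => s.author t ≠ j)).map
    fun t => ⟨s.vtx j t k, s.oid t, s.globForm ot t j k, s.locForm ot t j k⟩ with hl₁
  set l₂ : List (PathNode n U) := ((List.range' (s.clock a i) (b - s.clock a i)).filter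
    (fun _ => True)).map fun t => ⟨s.vtx i a t, (i, t + 1), s.locForm ot a i t,
      s.globForm ot a i t⟩ with hl₂
  have hmem₁ : ∀ t, p ≤ t → t < a → s.author t ≠ j →
      (⟨s.vtx j t k, s.oid t, s.globForm ot t j k, s.locForm ot t j k⟩ : PathNode n U) ∈
        l₁ ++ l₂ := fun t h1 h2 h3 =>
    List.mem_append_left _ (mem_path_of_range.2 ⟨t, h1, h2, h3, rfl⟩)
  have hmem₂ : ∀ c, s.clock a i ≤ c → c < b →
      (⟨s.vtx i a c, (i, c + 1), s.locForm ot a i c, s.globForm ot a i c⟩ : PathNode n U) ∈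
        l₁ ++ l₂ := fun c h1 h2 =>
    List.mem_append_right _ (mem_path_of_range.2 ⟨c, h1, h2, trivial, rfl⟩)
  have hpath := hpath₁.append hpath₂
  have hfresh : ∀ u, z ∈ u → S.edges u = [] := by
    intro u hu
    by_contra h0
    exact hzq ((h.edges u h0).subset hu)
  have hend : S.edges (clockSet q) = [] := by
    by_contra h0
    exact ssubset_irrefl _ (h.edges _ h0)
  have hw : s.vtx j p k ∈ S.vertices := h.vertex j p k hpa (hck p hpa) hqj.ge hmono
  obtain ⟨S', g1, g2, g3, g4, g5, -, g6, g7, g8, g9, g10⟩ :=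
    Space.xFormLoop_eq (r := r) (A := A) (z := z) (w' := clockSet q) hzq hzA (l₁ ++ l₂) hpath
      (fuel := S.cur.card) (S := S.addVertex (insert z (s.vtx j p k))) (by rw [h.cur]; omega) h.cur
      (by
        intro nd hnd
        rcases List.mem_append.1 hnd with hnd | hnd
        · obtain ⟨t, ht, ht', hE, rfl⟩ := mem_path_of_range.1 hnd
          exact h.first j t k ht' hE (hck t ht'.le) hqj.ge fun c hc => (hmono c hc).trans ht
        · obtain ⟨c, hc, hc', -, rfl⟩ := mem_path_of_range.1 hnd
          exact h.pending i c hc (by rwa [hq, Function.update_self]))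
      (by
        intro nd hnd
        rcases List.mem_append.1 hnd with hnd | hnd
        · obtain ⟨t, ht, ht', hE, rfl⟩ := mem_path_of_range.1 hnd
          exact .inl (s.oid_mem_clockSet ht')
        · obtain ⟨c, hc, hc', -, rfl⟩ := mem_path_of_range.1 hnd
          obtain ⟨h1, h2⟩ := hr (hc.trans_lt hc')
          right
          rw [h2, hz]
          simpa using h1)
      (fun u hu => hfresh u (hu (Finset.mem_insert_self _ _))) hend
      (by simp [Space.addVertex])
  have hAA : A ⊆ clockSet (s.clock (a + 1)) :=
    clockSet_subset.2 (s.clock_mono (Nat.le_succ a))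
  -- The vertices and the new first edges along the two parts of the path.
  have hv₂ : ∀ c, s.clock a i ≤ c → c ≤ b → insert z (s.vtx i a c) ∈ S'.vertices := by
    intro c hc hcb
    rcases hcb.lt_or_eq with hcb | rfl
    · exact g5 _ (hmem₂ c hc hcb)
    · exact g4
  have hvA : insert z A ∈ S'.vertices := by
    rw [← hmain i]; exact hv₂ _ le_rfl hb
  have hv₁ : ∀ t, p ≤ t → t ≤ a → s.vtx j t (k + 1) ∈ S'.vertices := by
    intro t ht hta
    rw [← hinsj]
    rcases eq_or_exists_edge (E := fun t => s.author t ≠ j) (w := fun t => s.vtx j t k) hta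
      (fun t' _ _ h => hskip t' (not_not.1 h)) with he | ⟨t', h6, h7, h8, h9⟩
    · rw [he, hjk]; exact hvA
    · rw [h9]
      exact g5 _ (hmem₁ t' (ht.trans h6) h7 h8)
  have hf₂ : ∀ c, s.clock a i ≤ c → c ≤ b →
      S'.HasFirst A (s.vtx i a c) z (s.globForm ot a i c) := by
    intro c hc hcb
    rcases hcb.lt_or_eq with hcb | rfl
    · refine g7 _ (hmem₂ c hc hcb) ?_
      simp only [hA, mem_clockSet, not_and, not_le]
      omega
    · exact g8
  have hcases : ∀ j' c, c ≤ Function.update q j (k + 1) j' → c ≤ q j' ∨ j' = j ∧ c = k + 1 := by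
    intro j' c hc
    by_cases hjj : j' = j
    · subst hjj
      rw [Function.update_self] at hc
      omega
    · rw [Function.update_of_ne hjj] at hc
      exact .inl hc
  have hsucc : s.clock (a + 1) j = k + 1 := by rw [s.clock_succ_self hj, hk]
  have hsucc' : ∀ j' ≠ j, s.clock (a + 1) j' = s.clock a j' :=
    fun j' hj' => s.clock_succ_of_ne (by rw [hj]; exact hj'.symm)
  have hcur' : insert z (clockSet q) = clockSet (Function.update q j (k + 1)) := by
    rw [hz, ← hqj, insert_clockSet]
  refine ⟨S', ⟨s.globForm ot a i b, z, clockSet q, A⟩, ?_, rfl, ?_⟩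
  · rw [Space.xForm, if_pos hw]
    exact g1
  · refine ⟨by rw [g2, hcur'], ?_, ?_, ?_, ?_⟩
    · intro j' t c ht hc hcq hctx'
      rcases hcases j' c hcq with hcq' | ⟨rfl, rfl⟩
      · rcases Nat.le_succ_iff.1 ht with ht | rfl
        · exact g3 (Finset.mem_insert_of_mem (h.vertex j' t c ht hc hcq' hctx'))
        · have hjj : j' ≠ j := by
            rintro rfl
            rw [hsucc] at hc
            omega
          rw [hsucc' j' hjj] at hc
          rw [← hinsi j' hjj]
          by_cases hji : j' = i
          · subst hji
            rw [hq, Function.update_self] at hcq'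
            exact hv₂ c hc hcq'
          · obtain rfl := hother j' hji c hc hcq'
            rw [hmain]; exact hvA
      · have hpt : p ≤ t := hp ▸ hctx' k (Nat.lt_succ_self k)
        rcases Nat.le_succ_iff.1 ht with ht | rfl
        · exact hv₁ t hpt ht
        · rw [s.vtx_succ_self _ hj]
          exact hv₁ a hpa le_rfl
    · intro j' t c ht hjt hc hcq hctx'
      refine Space.HasFirst.mono ?_ hAA
      rcases Nat.lt_succ_iff_lt_or_eq.1 ht with hta | rfl
      · rcases hcases j' c hcq with hcq' | ⟨rfl, rfl⟩
        · have hf := h.first j' t c hta hjt hc hcq' hctx'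
          exact g6 _ _ _ (fun hzu => hf.edges_ne_nil (hfresh _ hzu)) (s.oid_mem_clockSet hta) hf
        · have hpt : p ≤ t := hp ▸ hctx' k (Nat.lt_succ_self k)
          rw [← hinsj, s.globForm_succ (hck t hta.le)]
          exact g9 _ (hmem₁ t hpt hta hjt)
      · have hjj : j' ≠ j := by rintro rfl; exact hjt hj
        have hcq' := (hcases j' c hcq).resolve_right fun hh => hjj hh.1
        by_cases hji : j' = i
        · subst hji
          rw [hq, Function.update_self] at hcq'
          exact hf₂ c hc hcq'
        · obtain rfl := hother j' hji c hc hcq'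
          have := hf₂ _ le_rfl hb
          rw [hmain, s.globForm_clock] at this ⊢
          exact this
    · intro j' c hc hcq
      have hjj : j' ≠ j := by
        rintro rfl
        rw [hsucc] at hc
        rw [Function.update_self] at hcq
        omega
      rw [hsucc' j' hjj] at hc
      rw [Function.update_of_ne hjj] at hcq
      obtain rfl : j' = i := by
        by_contra hji
        have := hother j' hji c hc hcq.le
        rw [hq, Function.update_of_ne hji] at hcq
        omega
      rw [hq, Function.update_self] at hcq
      rw [← hinsi j' hjj, s.locForm_succ_of_ne (hctx c hcq hc) (by rw [hj]; exact hjj.symm)]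
      exact (g9 _ (hmem₂ c hc hcq)).mono hAA
    · intro u hu
      rw [← hcur']
      rcases g10 u hu with h1 | h1
      · exact (h.edges u h1).trans (Finset.ssubset_insert hzq)
      · exact h1

variable (s ot) in
/-- CJupiter: the server sends its operations in the form in which they have been generated. -/
noncomputable def realization : s.Realization ot (protocol n ot) where
  upMsg i b := (⟨s.orig i b, (i, b + 1), s.vtx i (s.ctxIdx i b) b, ∅⟩ : Op n U)
  downMsg a := (⟨s.orig (s.author a) (s.clock a (s.author a)), s.oid a,
    s.vtx (s.author a) (s.ctxIdx (s.author a) (s.clock a (s.author a)))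
      (s.clock a (s.author a)), clockSet (s.clock a)⟩ : Op n U)
  Client i a b C :=
    C.cid = i ∧ C.seq = b ∧ StateSpace s ot C.S a (Function.update (s.clock a) i b)
  Server a S := S.soids = clockSet (s.clock a) ∧ StateSpace s ot S.S a (s.clock a)
  client₀ i := by
    refine ⟨⟨rfl, rfl, ?_⟩, rfl⟩
    rw [s.clock_zero, Function.update_eq_self]
    exact stateSpace_empty
  server₀ := by
    rw [s.clock_zero, clockSet_zero]
    exact ⟨⟨rfl, stateSpace_empty⟩, rfl⟩
  msgOid_up _ _ := rfl
  msgOid_down _ := rfl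
  clientDo := by
    rintro i a b C ⟨rfl, rfl, h⟩ ha
    refine ⟨_, Prod.ext rfl ?_, ⟨rfl, rfl, h.doOp (r := .client C.cid)
      (op := ⟨s.orig C.cid C.seq, (C.cid, C.seq + 1), C.S.cur, ∅⟩) ha rfl rfl rfl⟩, rfl⟩
    rw [← ha, Sched.vtx, ← h.cur]
    rfl
  clientReceive := by
    rintro i a a' b C ⟨h1, h2, h⟩ ha hown hi hb hctx hcausal
    subst h1
    obtain ⟨S', op, hx, ho, hS'⟩ := (h.absorb ha hown hb hctx).receive (r := .client C.cid) hb
      (fun _ => ⟨hi, rfl⟩) (fun c hc _ => (hctx c hc).trans ha) hcausal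
    refine ⟨⟨C.cid, C.seq, C.state ++ [s.globForm ot a' C.cid b], S'⟩, ?_, ⟨rfl, h2, ?_⟩, rfl⟩
    · simp only [protocol, Client.receive, hx, Option.map_some, ho]
    · rw [Function.update_comm (Ne.symm hi), ← s.clock_succ] at hS'
      exact hS'
  serverReceive := by
    rintro a S ⟨h1, h⟩ hcausal
    rw [← Function.update_eq_self (s.author a) (s.clock a)] at h
    obtain ⟨S', op, hx, ho, hS'⟩ := h.receive (r := .server) le_rfl
      (fun hlt => absurd hlt (lt_irrefl _)) (fun c hc hc' => absurd hc (not_lt.2 hc')) hcausal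
    rw [s.globForm_clock] at ho
    rw [Function.update_eq_self, ← s.clock_succ] at hS'
    refine ⟨⟨S.state ++ [s.serverForm ot a], clockSet (s.clock (a + 1)), S'⟩, ?_, ⟨rfl, hS'⟩, rfl⟩
    rw [Sched.oid, ← h1] at hx
    rw [← s.insert_oid_clockSet, ← h1]
    simp only [protocol, Server.receive, hx, Option.map_some, ho]
    rfl

end CJupiter

/-! ### The schedule of an execution -/

section Counts

variable (i : Fin n) (l : List (Event n U)) (e : Event n U)

theorem sentToServer_snoc :
    sentToServer i (l ++ [e]) = sentToServer i l + sentToServer i [e] := by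
  simp [sentToServer, generated]

theorem receivedFrom_snoc :
    receivedFrom i (l ++ [e]) = receivedFrom i l + receivedFrom i [e] := by
  simp only [receivedFrom, List.countP_append]

theorem sentToClient_snoc :
    sentToClient i (l ++ [e]) = sentToClient i l + sentToClient i [e] := by
  simp only [sentToClient, List.countP_append]

theorem receivedBy_snoc :
    receivedBy i (l ++ [e]) = receivedBy i l + receivedBy i [e] := by
  simp only [receivedBy, List.countP_append]

theorem serverOrder_snoc : serverOrder (l ++ [e]) = serverOrder l ++ (match e with
    | .serverRecv i => [(i, receivedFrom i l + 1)]
    | _ => []) := by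
  rw [serverOrder, List.length_append, List.length_singleton, List.range_succ,
    List.filterMap_append]
  congr 1
  · refine List.filterMap_congr fun q hq => ?_
    have hq := List.mem_range.1 hq
    rw [List.getElem?_append_left hq, List.take_append_of_le_length hq.le]
  · cases e <;> simp

/-- The number of operations that the server has received. -/
def serverCount (α : List (Event n U)) : ℕ := (serverOrder α).length

theorem serverCount_snoc :
    serverCount (l ++ [e]) = serverCount l + serverCount [e] := by
  rw [serverCount, serverOrder_snoc, ← List.nil_append [e], serverCount, serverCount,
    serverOrder_snoc]
  cases e <;> simp [serverOrder]

end Counts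

section Singletons

variable (i j : Fin n) (o : ListOp U)

@[simp] theorem sentToServer_gen : sentToServer i [.gen j o] = if j = i then 1 else 0 := by
  by_cases h : j = i <;> simp [sentToServer, generated, h]

@[simp] theorem sentToServer_serverRecv : sentToServer i [(.serverRecv j : Event n U)] = 0 := by
  simp [sentToServer, generated]

@[simp] theorem sentToServer_clientRecv : sentToServer i [(.clientRecv j : Event n U)] = 0 := by
  simp [sentToServer, generated]

@[simp] theorem receivedFrom_gen : receivedFrom i [.gen j o] = 0 := by
  simp [receivedFrom]

@[simp] theorem receivedFrom_serverRecv : receivedFrom i [(.serverRecv j : Event n U)] =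
    if j = i then 1 else 0 := by
  by_cases h : j = i <;> simp [receivedFrom, h]

@[simp] theorem receivedFrom_clientRecv : receivedFrom i [(.clientRecv j : Event n U)] = 0 := by
  simp [receivedFrom]

@[simp] theorem sentToClient_gen : sentToClient i [.gen j o] = 0 := by
  simp [sentToClient]

@[simp] theorem sentToClient_serverRecv : sentToClient i [(.serverRecv j : Event n U)] =
    if j = i then 0 else 1 := by
  by_cases h : j = i <;> simp [sentToClient, h]

@[simp] theorem sentToClient_clientRecv : sentToClient i [(.clientRecv j : Event n U)] = 0 := by
  simp [sentToClient]

@[simp] theorem receivedBy_gen : receivedBy i [.gen j o] = 0 := by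
  simp [receivedBy]

@[simp] theorem receivedBy_serverRecv : receivedBy i [(.serverRecv j : Event n U)] = 0 := by
  simp [receivedBy]

@[simp] theorem receivedBy_clientRecv : receivedBy i [(.clientRecv j : Event n U)] =
    if j = i then 1 else 0 := by
  by_cases h : j = i <;> simp [receivedBy, h]

@[simp] theorem serverCount_gen : serverCount [.gen j o] = 0 := by
  simp [serverCount, serverOrder]

@[simp] theorem serverCount_serverRecv : serverCount [(.serverRecv j : Event n U)] = 1 := by
  simp [serverCount, serverOrder]

@[simp] theorem serverCount_clientRecv : serverCount [(.clientRecv j : Event n U)] = 0 := by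
  simp [serverCount, serverOrder]

end Singletons

theorem take_succ_of_some {α : List (Event n U)} {q : ℕ} {e : Event n U} (h : α[q]? = some e) :
    α.take (q + 1) = α.take q ++ [e] := by
  rw [List.take_add_one, h]; rfl

theorem take_succ_of_none {α : List (Event n U)} {q : ℕ} (h : α[q]? = none) :
    α.take (q + 1) = α.take q := by
  rw [List.take_add_one, h]; simp

/-- A counter of events that is changed by single steps takes every value. -/
theorem exists_jump {α : List (Event n U)} (c : List (Event n U) → ℕ) (h0 : c [] = 0)
    (hc : ∀ l e, c (l ++ [e]) = c l + c [e]) (h1 : ∀ e, c [e] ≤ 1) {m k : ℕ}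
    (h : m < c (α.take k)) :
    ∃ q < k, ∃ e, α[q]? = some e ∧ c (α.take q) = m ∧ c [e] = 1 := by
  induction k with
  | zero => simp [h0] at h
  | succ k ih =>
    by_cases hm : m < c (α.take k)
    · obtain ⟨q, hq, h2⟩ := ih hm
      exact ⟨q, by omega, h2⟩
    · cases he : α[k]? with
      | none => rw [take_succ_of_none he] at h; exact absurd h hm
      | some e =>
        rw [take_succ_of_some he, hc] at h
        have := h1 e
        exact ⟨k, Nat.lt_succ_self k, e, he, by omega, by omega⟩

theorem counter_mono {α : List (Event n U)} (c : List (Event n U) → ℕ)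
    (hc : ∀ l e, c (l ++ [e]) = c l + c [e]) {k k' : ℕ} (h : k ≤ k') :
    c (α.take k) ≤ c (α.take k') := by
  induction k', h using Nat.le_induction with
  | base => exact le_rfl
  | succ k' _ ih =>
    cases he : α[k']? with
    | none => rwa [take_succ_of_none he]
    | some e => rw [take_succ_of_some he, hc]; omega

theorem serverOrder_prefix (l l' : List (Event n U)) : serverOrder l <+: serverOrder (l ++ l') := by
  induction l' using List.reverseRecOn with
  | nil => simp
  | append_singleton l' e ih =>
    rw [← List.append_assoc, serverOrder_snoc]
    exact ih.trans (List.prefix_append _ _)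

theorem serverOrder_getElem {α : List (Event n U)} {q : ℕ} {i : Fin n}
    (h : α[q]? = some (.serverRecv i)) :
    (serverOrder α)[serverCount (α.take q)]? = some (i, receivedFrom i (α.take q) + 1) := by
  have hp := serverOrder_prefix (α.take (q + 1)) (α.drop (q + 1))
  rw [List.take_append_drop, take_succ_of_some h, serverOrder_snoc] at hp
  obtain ⟨t, ht⟩ := hp
  rw [← ht, List.append_assoc, serverCount, List.getElem?_append_right le_rfl]
  simp

theorem count_congr {p q : ℕ → Prop} [DecidablePred p] [DecidablePred q] {N : ℕ}
    (h : ∀ a < N, (p a ↔ q a)) : Nat.count p N = Nat.count q N := by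
  rw [Nat.count_eq_card_filter_range, Nat.count_eq_card_filter_range]
  exact congrArg Finset.card (Finset.filter_congr fun a ha => h a (Finset.mem_range.1 ha))

/-- The identifier of the operation number `a` of the server. -/
def orderOid (i₀ : Fin n) (α : List (Event n U)) (a : ℕ) : Oid n :=
  (serverOrder α)[a]?.getD (i₀, 0)

open Classical in
/-- The schedule of an execution, in terms of the data that are the same for all executions with the
same schedule.  The client `i₀` and the operation `nop` are arbitrary values for the numbers that do
not occur. -/
noncomputable def schedOf (i₀ : Fin n) (α : List (Event n U)) : Sched n U where
  author a := (orderOid i₀ α a).1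
  orig i b := (generated i α)[b]?.getD .nop
  known i b := Nat.count (fun a => (orderOid i₀ α a).1 ≠ i ∧
    OpCausallyBefore α (orderOid i₀ α a) (i, b + 1)) (serverCount α)

theorem SameSchedule.schedOf_eq {α β : List (Event n U)} (h : SameSchedule α β) (i₀ : Fin n) :
    schedOf i₀ α = schedOf i₀ β := by
  classical
  have hx : orderOid i₀ α = orderOid i₀ β := by
    funext a; rw [orderOid, orderOid, h.server]
  have hN : serverCount α = serverCount β := by rw [serverCount, serverCount, h.server]
  have hc : OpCausallyBefore α = OpCausallyBefore β := by
    funext x y; exact propext (h.causal x y)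
  ext
  · simp only [schedOf, hx]
  · simp only [schedOf, h.operations]
  · simp only [schedOf, hN]
    exact count_congr fun a _ => by rw [hx, hc]

section Extraction

variable {i₀ : Fin n} {α : List (Event n U)}

theorem author_schedOf {q : ℕ} {i : Fin n} (h : α[q]? = some (.serverRecv i)) :
    (schedOf i₀ α).author (serverCount (α.take q)) = i := by
  simp [schedOf, orderOid, serverOrder_getElem h]

theorem clock_schedOf (i : Fin n) (k : ℕ) :
    (schedOf i₀ α).clock (serverCount (α.take k)) i = receivedFrom i (α.take k) := by
  induction k with
  | zero => simp [serverCount, serverOrder, Sched.clock, receivedFrom]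
  | succ k ih =>
    cases he : α[k]? with
    | none => rwa [take_succ_of_none he]
    | some e =>
      rw [take_succ_of_some he, serverCount_snoc, receivedFrom_snoc]
      cases e with
      | gen j o => simpa using ih
      | clientRecv j => simpa using ih
      | serverRecv j =>
        have hj := author_schedOf (i₀ := i₀) he
        rw [serverCount_serverRecv, receivedFrom_serverRecv]
        by_cases h : j = i
        · rw [Sched.clock_succ_self (hj.trans h), ih, if_pos h]
        · rw [Sched.clock_succ_of_ne (by rwa [hj]), ih, if_neg h, Nat.add_zero]

theorem remote_schedOf (i : Fin n) (k : ℕ) :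
    (schedOf i₀ α).remote i (serverCount (α.take k)) = sentToClient i (α.take k) := by
  induction k with
  | zero => simp [serverCount, serverOrder, Sched.remote, sentToClient]
  | succ k ih =>
    cases he : α[k]? with
    | none => rwa [take_succ_of_none he]
    | some e =>
      rw [take_succ_of_some he, serverCount_snoc, sentToClient_snoc]
      cases e with
      | gen j o => simpa using ih
      | clientRecv j => simpa using ih
      | serverRecv j =>
        have hj := author_schedOf (i₀ := i₀) he
        rw [serverCount_serverRecv, sentToClient_serverRecv]
        by_cases h : j = i
        · rw [Sched.remote_succ_self (hj.trans h), ih, if_pos h, Nat.add_zero]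
        · rw [Sched.remote_succ_of_ne (by rwa [hj]), ih, if_neg h]

theorem exists_serverRecv {a k : ℕ} (h : a < serverCount (α.take k)) :
    ∃ q < k, ∃ j, α[q]? = some (.serverRecv j) ∧ serverCount (α.take q) = a := by
  obtain ⟨q, hq, e, he, h1, h2⟩ := exists_jump serverCount (by simp [serverCount, serverOrder])
    serverCount_snoc (fun e => by cases e <;> simp [serverCount, serverOrder]) h
  cases e with
  | gen j o => simp at h2
  | clientRecv j => simp at h2
  | serverRecv j => exact ⟨q, hq, j, he, h1⟩

theorem exists_gen {i : Fin n} {b k : ℕ} (h : b < sentToServer i (α.take k)) :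
    ∃ q < k, ∃ o, α[q]? = some (.gen i o) ∧ sentToServer i (α.take q) = b := by
  obtain ⟨q, hq, e, he, h1, h2⟩ := exists_jump (sentToServer i) rfl (sentToServer_snoc i)
    (fun e => by
      cases e with
      | gen j o => rw [sentToServer_gen]; split <;> omega
      | clientRecv j => simp
      | serverRecv j => simp) h
  cases e with
  | gen j o =>
    rw [sentToServer_gen] at h2
    obtain rfl : j = i := by by_contra hne; simp [hne] at h2
    exact ⟨q, hq, o, he, h1⟩
  | clientRecv j => simp at h2
  | serverRecv j => simp at h2

theorem exists_clientRecv {i : Fin n} {r k : ℕ} (h : r < receivedBy i (α.take k)) :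
    ∃ q < k, α[q]? = some (.clientRecv i) ∧ receivedBy i (α.take q) = r := by
  obtain ⟨q, hq, e, he, h1, h2⟩ := exists_jump (receivedBy i) rfl (receivedBy_snoc i)
    (fun e => by
      cases e with
      | gen j o => simp
      | clientRecv j => rw [receivedBy_clientRecv]; split <;> omega
      | serverRecv j => simp) h
  cases e with
  | gen j o => simp at h2
  | serverRecv j => simp at h2
  | clientRecv j =>
    rw [receivedBy_clientRecv] at h2
    obtain rfl : j = i := by by_contra hne; simp [hne] at h2
    exact ⟨q, hq, he, h1⟩

theorem orderOid_eq {a : ℕ} (ha : a < serverCount α) :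
    orderOid i₀ α a = (schedOf i₀ α).oid a := by
  rw [← List.take_length (l := α)] at ha
  obtain ⟨q, -, j, hq, rfl⟩ := exists_serverRecv ha
  rw [orderOid, serverOrder_getElem hq, Sched.oid, author_schedOf hq, clock_schedOf]
  rfl

/-! ### Causality -/

variable (i₀ α) in
/-- A vector clock for the operations that a replica knows after the first `k` events: those of the
server that it has received, and its own ones. -/
noncomputable def knowledge (k : ℕ) : Replica n → Fin n → ℕ
  | .server => (schedOf i₀ α).clock (serverCount (α.take k))
  | .client i => Function.update
      ((schedOf i₀ α).clock ((schedOf i₀ α).pos i (receivedBy i (α.take k)))) i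
      (sentToServer i (α.take k))

theorem receivedBy_le_remote (hα : WellFormed α) (i : Fin n) (k : ℕ) :
    receivedBy i (α.take k) ≤ (schedOf i₀ α).remote i (serverCount (α.take k)) := by
  rw [remote_schedOf]
  exact (hα k i).2

theorem knowledge_mono (hα : WellFormed α) (R : Replica n) {k k' : ℕ} (h : k ≤ k') :
    knowledge i₀ α k R ≤ knowledge i₀ α k' R := by
  cases R with
  | server => exact Sched.clock_mono (counter_mono _ serverCount_snoc h)
  | client i =>
    intro j
    simp only [knowledge]
    by_cases hj : j = i
    · subst hj
      simpa using counter_mono (sentToServer j) (sentToServer_snoc j) h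
    · rw [Function.update_of_ne hj, Function.update_of_ne hj]
      exact Sched.clock_mono (Sched.pos_mono
        (counter_mono (receivedBy i) (receivedBy_snoc i) h) (receivedBy_le_remote hα i k')) j

/-- Knowledge is passed on along the causally-before relation. -/
theorem CausalStep.knowledge_le (hα : WellFormed α) {p q : ℕ} (h : CausalStep α p q) :
    ∃ e e', α[p]? = some e ∧ α[q]? = some e' ∧
      knowledge i₀ α (p + 1) e.replica ≤ knowledge i₀ α (q + 1) e'.replica := by
  cases h with
  | @thread e e' hp hq hR hpq =>
    exact ⟨e, e', hp, hq, hR ▸ knowledge_mono hα _ (by omega)⟩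
  | @toServer i o hp hq hm =>
    refine ⟨_, _, hp, hq, ?_⟩
    have hp' := take_succ_of_some hp
    have hq' := take_succ_of_some hq
    have h1 : receivedFrom i (α.take (q + 1)) = receivedFrom i (α.take q) + 1 := by
      rw [hq', receivedFrom_snoc]; simp
    have h2 : sentToServer i (α.take (p + 1)) = sentToServer i (α.take p) + 1 := by
      rw [hp', sentToServer_snoc]; simp
    have hpq : p < q := by
      rcases lt_trichotomy p q with h | rfl | h
      · exact h
      · rw [hp] at hq; simp at hq
      · have h3 := (hα (q + 1) i).1
        have h4 := counter_mono (α := α) (sentToServer i) (sentToServer_snoc i)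
          (show q + 1 ≤ p from h)
        omega
    intro j
    simp only [knowledge, Event.replica]
    by_cases hj : j = i
    · subst hj
      rw [Function.update_self, clock_schedOf, h1, h2, hm]
    · rw [Function.update_of_ne hj]
      exact Sched.clock_mono ((Sched.pos_le (receivedBy_le_remote hα i (p + 1))).trans
        (counter_mono _ serverCount_snoc (by omega))) j
  | @toClient i j hp hq hij hm =>
    refine ⟨_, _, hp, hq, ?_⟩
    have hp' := take_succ_of_some hp
    have hq' := take_succ_of_some hq
    have h1 : receivedBy i (α.take (q + 1)) = receivedBy i (α.take q) + 1 := by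
      rw [hq', receivedBy_snoc]; simp
    have h2 : serverCount (α.take (p + 1)) = serverCount (α.take p) + 1 := by
      rw [hp', serverCount_snoc]; simp
    have h3 : sentToClient i (α.take (p + 1)) = sentToClient i (α.take p) + 1 := by
      rw [hp', sentToClient_snoc]; simp [hij]
    have hpq : p < q := by
      rcases lt_trichotomy p q with h | rfl | h
      · exact h
      · rw [hp] at hq; simp at hq
      · have h4 := (hα (q + 1) i).2
        have h5 := counter_mono (α := α) (sentToClient i) (sentToClient_snoc i)
          (show q + 1 ≤ p from h)
        omega
    have hpos : (schedOf i₀ α).pos i (receivedBy i (α.take (q + 1))) =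
        serverCount (α.take (p + 1)) := by
      rw [h1, ← hm, ← remote_schedOf (i₀ := i₀),
        Sched.pos_remote_succ (by rwa [author_schedOf hp]), h2]
    intro j'
    simp only [knowledge, Event.replica, hpos]
    by_cases hj : j' = i
    · subst hj
      rw [Function.update_self, clock_schedOf]
      exact (hα (p + 1) j').1.trans (counter_mono _ (sentToServer_snoc j') (by omega))
    · rw [Function.update_of_ne hj]

theorem CausallyBefore.knowledge_le (hα : WellFormed α) {p q : ℕ} (h : CausallyBefore α p q) :
    ∃ e e', α[p]? = some e ∧ α[q]? = some e' ∧
      knowledge i₀ α (p + 1) e.replica ≤ knowledge i₀ α (q + 1) e'.replica := by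
  induction h with
  | single h => exact h.knowledge_le hα
  | tail _ h ih =>
    obtain ⟨e₁, e₂, h1, h2, h3⟩ := ih
    obtain ⟨e₃, e₄, h4, h5, h6⟩ := CausalStep.knowledge_le (i₀ := i₀) hα h
    obtain rfl : e₂ = e₃ := Option.some.inj (h2.symm.trans h4)
    exact ⟨e₁, e₄, h1, h5, h3.trans h6⟩

theorem gen_position_unique {p q : ℕ} {i : Fin n} {o o' : ListOp U} (hp : α[p]? = some (.gen i o))
    (hq : α[q]? = some (.gen i o'))
    (h : sentToServer i (α.take p) = sentToServer i (α.take q)) : p = q := by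
  have aux : ∀ {p q : ℕ} {o : ListOp U}, α[p]? = some (.gen i o) → p < q →
      sentToServer i (α.take p) < sentToServer i (α.take q) := by
    intro p q o hp hpq
    have h1 := counter_mono (α := α) (sentToServer i) (sentToServer_snoc i)
      (show p + 1 ≤ q from hpq)
    rw [take_succ_of_some hp, sentToServer_snoc] at h1
    rw [sentToServer_gen, if_pos rfl] at h1
    omega
  rcases lt_trichotomy p q with hlt | rfl | hlt
  · exact absurd h (aux hp hlt).ne
  · rfl
  · exact absurd h (aux hq hlt).ne'

/-- An operation of another client precedes an operation that is generated by client `i` if and only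
if it is among the operations that `i` has received. -/
theorem opCausallyBefore_iff (hα : WellFormed α) {k : ℕ} {i : Fin n} {o : ListOp U}
    (hk : α[k]? = some (.gen i o)) {a : ℕ} (ha : a < serverCount α)
    (hi : (schedOf i₀ α).author a ≠ i) :
    OpCausallyBefore α ((schedOf i₀ α).oid a) (i, sentToServer i (α.take k) + 1) ↔
      (schedOf i₀ α).remote i a < receivedBy i (α.take k) := by
  set s := schedOf i₀ α with hs
  constructor
  · rintro ⟨P, Q, ⟨oP, hP, hPn⟩, ⟨oQ, hQ, hQn⟩, hPQ⟩
    obtain rfl : Q = k := gen_position_unique hQ hk (by simpa using hQn.symm)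
    obtain ⟨e, e', h1, h2, h3⟩ := CausallyBefore.knowledge_le (i₀ := i₀) hα hPQ
    obtain rfl := Option.some.inj (hP.symm.trans h1)
    obtain rfl := Option.some.inj (hk.symm.trans h2)
    have h4 := h3 (s.author a)
    simp only [knowledge, Event.replica, Sched.oid, Function.update_self] at h4 hPn
    rw [Function.update_of_ne hi, take_succ_of_some hk, receivedBy_snoc, take_succ_of_some hP,
      sentToServer_snoc] at h4
    simp only [Sched.oid, receivedBy_gen, sentToServer_gen, if_true, Nat.add_zero] at h4
    rw [← hPn] at h4
    by_contra! hge
    have h5 := Sched.pos_le hge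
    exact absurd (h4.trans (Sched.clock_mono h5 (s.author a))) (Nat.not_succ_le_self _)
  · intro hlt
    rw [← List.take_length (l := α)] at ha
    obtain ⟨q, -, j, hq, rfl⟩ := exists_serverRecv ha
    have hj : s.author (serverCount (α.take q)) = j := author_schedOf hq
    have hc : s.clock (serverCount (α.take q)) j = receivedFrom j (α.take q) := clock_schedOf j q
    rw [remote_schedOf] at hlt
    obtain ⟨t, ht, htr, htn⟩ := exists_clientRecv hlt
    have h1 := (hα (q + 1) j).1
    rw [take_succ_of_some hq, receivedFrom_snoc, ← take_succ_of_some hq] at h1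
    rw [receivedFrom_serverRecv, if_pos rfl] at h1
    obtain ⟨p, hp, o', hpo, hpn⟩ := exists_gen h1
    refine ⟨p, k, ⟨o', ?_, ?_⟩, ⟨o, hk, rfl⟩, ?_⟩
    · simpa [Sched.oid, hj] using hpo
    · simp [Sched.oid, hj, hpn, hc]
    · refine (Relation.TransGen.single (CausalStep.toServer hpo hq hpn)).trans ?_
      refine (Relation.TransGen.single (CausalStep.toClient hq htr (hj ▸ hi) htn.symm)).trans ?_
      exact Relation.TransGen.single (CausalStep.thread htr hk rfl ht)

open Classical in
theorem Sched.count_remote_lt (s : Sched n U) (i : Fin n) (r N : ℕ) :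
    Nat.count (fun a => s.author a ≠ i ∧ s.remote i a < r) N = min r (s.remote i N) := by
  induction N with
  | zero =>
    rw [Nat.count_zero]
    simp [Sched.remote]
  | succ N ih =>
    rw [Nat.count_succ, ih]
    by_cases h : s.author N = i
    · rw [Sched.remote_succ_self h, if_neg (fun h' => h'.1 h), Nat.add_zero]
    · rw [Sched.remote_succ_of_ne h]
      by_cases h' : s.remote i N < r
      · rw [if_pos ⟨h, h'⟩]; omega
      · rw [if_neg (fun hh => h' hh.2)]; omega

theorem known_schedOf (hα : WellFormed α) {k : ℕ} {i : Fin n} {o : ListOp U}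
    (hk : α[k]? = some (.gen i o)) :
    (schedOf i₀ α).known i (sentToServer i (α.take k)) = receivedBy i (α.take k) := by
  classical
  have h1 : receivedBy i (α.take k) ≤ (schedOf i₀ α).remote i (serverCount α) := by
    refine (receivedBy_le_remote hα i k).trans (Sched.remote_mono i ?_)
    exact (serverOrder_prefix (α.take k) (α.drop k)).length_le.trans_eq
      (by rw [List.take_append_drop, serverCount])
  have h2 := Sched.count_remote_lt (schedOf i₀ α) i (receivedBy i (α.take k)) (serverCount α)
  rw [min_eq_left h1] at h2
  refine Eq.trans (count_congr fun a ha => and_congr_right fun hi => ?_) h2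
  rw [orderOid_eq ha]
  exact opCausallyBefore_iff hα hk ha hi

/-! ### Executions follow their schedules -/

/-- The abstract state counts the events that have occurred. -/
theorem foldl_globalNext (s : Sched n U) (ot : ListOp U → ListOp U → ListOp U)
    (l : List (Event n U)) :
    (l.foldl (s.globalNext ot) (initialState n U) .server).recv = serverCount l ∧
      ∀ i, (l.foldl (s.globalNext ot) (initialState n U) (.client i)).gen = sentToServer i l ∧
        (l.foldl (s.globalNext ot) (initialState n U) (.client i)).recv = receivedBy i l := by
  induction l using List.reverseRecOn with
  | nil => simp [initialState, serverCount, serverOrder, sentToServer, generated, receivedBy]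
  | append_singleton l e ih =>
    obtain ⟨h1, h2⟩ := ih
    rw [List.foldl_append, List.foldl_cons, List.foldl_nil]
    refine ⟨?_, fun i => ⟨?_, ?_⟩⟩
    · rw [serverCount_snoc]
      cases e with
      | gen j o => simpa [Sched.globalNext, Event.replica] using h1
      | clientRecv j => simpa [Sched.globalNext, Event.replica] using h1
      | serverRecv j =>
        simpa [Sched.globalNext, Event.replica, Sched.next] using h1
    · rw [sentToServer_snoc, ← (h2 i).1]
      cases e with
      | gen j o =>
        by_cases hj : j = i
        · subst hj; simp [Sched.globalNext, Event.replica, Sched.next]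
        · simp [Sched.globalNext, Event.replica, hj, Ne.symm hj]
      | clientRecv j =>
        by_cases hj : j = i
        · subst hj; simp [Sched.globalNext, Event.replica, Sched.next]
        · simp [Sched.globalNext, Event.replica, Ne.symm hj]
      | serverRecv j => simp [Sched.globalNext, Event.replica]
    · rw [receivedBy_snoc, ← (h2 i).2]
      cases e with
      | gen j o =>
        by_cases hj : j = i
        · subst hj; simp [Sched.globalNext, Event.replica, Sched.next]
        · simp [Sched.globalNext, Event.replica, Ne.symm hj]
      | clientRecv j =>
        by_cases hj : j = i
        · subst hj; simp [Sched.globalNext, Event.replica, Sched.next]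
        · simp [Sched.globalNext, Event.replica, hj, Ne.symm hj]
      | serverRecv j => simp [Sched.globalNext, Event.replica]

theorem Sched.follows_of_enabled {s : Sched n U} {ot : ListOp U → ListOp U → ListOp U}
    {es : List (Event n U)} {st : GlobalState n U}
    (h : ∀ l e l', es = l ++ e :: l' → s.Enabled (l.foldl (s.globalNext ot) st) e) :
    s.Follows ot st es := by
  induction es generalizing st with
  | nil => trivial
  | cons e es ih =>
    refine ⟨h [] e es rfl, ih fun l e' l' hl => ?_⟩
    exact h (e :: l) e' l' (by rw [hl]; rfl)

theorem generated_getElem (i : Fin n) (o : ListOp U) (l l' : List (Event n U)) :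
    (generated i (l ++ .gen i o :: l'))[sentToServer i l]? = some o := by
  simp [generated, sentToServer]

theorem WellFormed.follows (hα : WellFormed α) (ot : ListOp U → ListOp U → ListOp U) :
    (schedOf i₀ α).Follows ot (initialState n U) α := by
  refine Sched.follows_of_enabled fun l e l' hl => ?_
  obtain ⟨h1, h2⟩ := foldl_globalNext (schedOf i₀ α) ot l
  have hk : α[l.length]? = some e := by rw [hl]; simp
  have ht : α.take l.length = l := by rw [hl]; simp
  have hwf := hα (l.length + 1)
  rw [take_succ_of_some hk, ht] at hwf
  cases e with
  | gen i o =>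
    have hn := known_schedOf (i₀ := i₀) hα hk
    rw [ht] at hn
    refine ⟨?_, ?_⟩
    · rw [(h2 i).1]
      change (generated i α)[_]?.getD _ = o
      rw [hl, generated_getElem]
      rfl
    · rw [(h2 i).1, (h2 i).2, hn]
  | serverRecv i =>
    have ha := author_schedOf (i₀ := i₀) hk
    have hc := clock_schedOf (i₀ := i₀) (α := α) i l.length
    rw [ht] at ha hc
    refine ⟨by rw [h1, ha], ?_⟩
    have := (hwf i).1
    rw [receivedFrom_snoc, sentToServer_snoc, receivedFrom_serverRecv, if_pos rfl,
      sentToServer_serverRecv] at this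
    rw [h1, (h2 i).1, hc]
    exact this
  | clientRecv i =>
    have hr := remote_schedOf (i₀ := i₀) (α := α) i l.length
    rw [ht] at hr
    have := (hwf i).2
    rw [receivedBy_snoc, sentToClient_snoc, receivedBy_clientRecv, if_pos rfl,
      sentToClient_clientRecv] at this
    simp only [Sched.Enabled]
    rw [h1, (h2 i).2, hr]
    exact this

end Extraction

theorem generated_eventsAt (i : Fin n) (α : List (Event n U)) (R : Replica n) :
    generated i (eventsAt α R) = if R = .client i then generated i α else [] := by
  induction α with
  | nil => simp [generated, eventsAt]
  | cons e es ih =>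
    simp only [generated, eventsAt, List.filter_cons, List.filterMap_cons] at ih ⊢
    cases e with
    | gen j o =>
      by_cases hR : R = .client j
      · subst hR
        by_cases hj : j = i <;> simp_all [Event.replica]
      · have hR' : ¬ Replica.client j = R := fun h => hR h.symm
        by_cases hj : j = i <;> simp_all [Event.replica]
    | serverRecv j => by_cases hR : Replica.server = R <;> simp_all [Event.replica]
    | clientRecv j => by_cases hR : Replica.client j = R <;> simp_all [Event.replica]

theorem length_eventsAt_server (α : List (Event n U)) :
    (eventsAt α .server).length = serverCount α := by
  induction α using List.reverseRecOn with
  | nil => rfl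
  | append_singleton l e ih =>
    rw [serverCount_snoc, ← ih]
    cases e with
    | gen j o => simp [eventsAt, Event.replica]
    | serverRecv j => simp [eventsAt, Event.replica]
    | clientRecv j => simp [eventsAt, Event.replica]

theorem eq_nil_of_isEmpty [IsEmpty (Fin n)] (α : List (Event n U)) : α = [] := by
  cases α with
  | nil => rfl
  | cons e es => cases e <;> exact isEmptyElim ‹Fin n›

end JupiterOT

open JupiterOT
theorem mainTheorem2 {U : Type*} (n : ℕ) (ot : ListOp U → ListOp U → ListOp U) (l₀ : List U)
    (α β : List (Event n U)) (hα : WellFormed α) (hβ : WellFormed β) (h : SameSchedule α β)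
    (R : Replica n) :
    ∃ bC bJ : List (Transition n U),
      (CJupiter.protocol n ot).behavior l₀ α R = some bC ∧
      (Jupiter.protocol n ot).behavior l₀ β R = some bJ ∧
      (bC <+: bJ ∨ bJ <+: bC) ∧
      (R = Replica.server ∨ (eventsAt α R).length = (eventsAt β R).length → bC = bJ) := by
  rcases isEmpty_or_nonempty (Fin n) with hn | ⟨⟨i₀⟩⟩
  · rw [eq_nil_of_isEmpty α, eq_nil_of_isEmpty β]
    exact ⟨[], [], rfl, rfl, .inl List.nil_prefix, fun _ => rfl⟩
  have hfα := hα.follows (i₀ := i₀) ot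
  have hfβ := hβ.follows (i₀ := i₀) ot
  rw [← h.schedOf_eq i₀] at hfβ
  set s := schedOf i₀ α
  have hpre : eventsAt α R <+: eventsAt β R ∨ eventsAt β R <+: eventsAt α R := by
    refine (hfα.locally R).comparable (hfβ.locally R) (R := R) ?_ ?_ fun i => ?_
    · intro e he; simpa [eventsAt] using (List.mem_filter.1 he).2
    · intro e he; simpa [eventsAt] using (List.mem_filter.1 he).2
    · rw [generated_eventsAt, generated_eventsAt, h.operations i]
  refine ⟨_, _, (CJupiter.realization s ot).behavior_eq l₀ hfα R,
    (Jupiter.realization s ot).behavior_eq l₀ hfβ R, ?_, ?_⟩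
  · exact hpre.imp (fun hp => Sched.localRun_prefix hp _) fun hp => Sched.localRun_prefix hp _
  · intro hlen
    have hlen : (eventsAt α R).length = (eventsAt β R).length := by
      rcases hlen with rfl | hlen
      · rw [length_eventsAt_server, length_eventsAt_server, serverCount, serverCount, h.server]
      · exact hlen
    have heq : eventsAt α R = eventsAt β R := by
      rcases hpre with hp | hp
      · exact hp.eq_of_length hlen
      · exact (hp.eq_of_length hlen.symm).symm
    rw [heq]
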